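/- Let $P,L,K\in\mathbb R^{d\times d}$ be symmetric positive definite, $T>0$, $\boldsymbol f\in L^2(0,T)^d$, $\hat{\boldsymbol u}_0,\hat{\boldsymbol u}_1\in\mathbb R^d$, and put $$\widetilde K=\begin{bmatrix}K&0\\0&P\end{bmatrix},\quad A=\begin{bmatrix}0&-K\\K&L\end{bmatrix},\quad \widetilde L=\begin{bmatrix}0&0\\0&L^{1/2}\end{bmatrix},\quad \boldsymbol F=\begin{bmatrix}\boldsymbol 0\\\boldsymbol f\end{bmatrix},\quad \boldsymbol z_0=\begin{bmatrix}\hat{\boldsymbol u}_0\\\hat{\boldsymbol u}_1\end{bmatrix}.$$ Let $\boldsymbol z\in H^1(0,T)^{2d}$ be the solution of $\widetilde K\dot{\boldsymbol z}+A\boldsymbol z=\boldsymbol F$ a.e. on $(0,T]$, $\boldsymbol z(0)=\boldsymbol z_0$. Let $0=t_0<t_1<\dots<t_N=T$, $I_n=(t_{n-1},t_n]$, $\Delta t_n=t_n-t_{n-1}$, let $r_1,\dots,r_N$ be non-negative integers, and let $\mathcal V^{\boldsymbol r}$ be the space of functions $\boldsymbol v:(0,T]\to\mathbb R^{2d}$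 such that each component of $\boldsymbol v|_{I_n}$ is a polynomial of degree at most $r_n$, $n=1,\dots,N$. Write $\boldsymbol v(t^\pm)$ for one-sided limits and $[\boldsymbol v]_n=\boldsymbol v(t_n^+)-\boldsymbol v(t_n^-)$. Let $\boldsymbol z_{DG}\in\mathcal V^{\boldsymbol r}$ be the discontinuous Galerkin approximation, i.e. for all $\boldsymbol v\in\mathcal V^{\boldsymbol r}$ $$\sum_{n=1}^N\int_{I_n}\big(\widetilde K\dot{\boldsymbol z}_{DG}+A\boldsymbol z_{DG}\big)\cdot\boldsymbol v\,dt+\sum_{n=1}^{N-1}\widetilde K[\boldsymbol z_{DG}]_n\cdot\boldsymbol v(t_n^+)+\widetilde K\boldsymbol z_{DG}(0^+)\cdot\boldsymbol v(0^+)=\sum_{n=1}^N\int_{I_n}\boldsymbol F\cdot\boldsymbol v\,dt+\widetilde K\boldsymbol z_0\cdot\boldsymbol v(0^+).$$ Let the energy (semi)norm be given by $$|||\boldsymbol e|||^2=\sum_{n=1}^N\|\widetilde L\boldsymbol e\|_{L^2(I_n)}^2+\tfrac12\|\widetilde K^{1/2}\boldsymbol e(0^+)\|^2+\tfrac12\sum_{n=1}^{N-1}\|\widetilde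 K^{1/2}[\boldsymbol e]_n\|^2+\tfrac12\|\widetilde K^{1/2}\boldsymbol e(T^-)\|^2 .$$ **Theorem.** If $\boldsymbol z|_{I_n}\in H^{s_n}(I_n)^{2d}$ with integers $s_n\ge2$ for $n=1,\dots,N$, then, with $\mu_n=\min(r_n,s_n)$, $$|||\boldsymbol z-\boldsymbol z_{DG}|||\le C\sum_{n=1}^N\Big(\frac{\Delta t_n}{2}\Big)^{\mu_n+\frac12}\Big((r_n+2)\frac{(r_n-\mu_n)!}{(r_n+\mu_n)!}\Big)^{\frac12}\|\boldsymbol z\|_{H^{\mu_n+1}(I_n)},$$ where the norm on the right is $\infty$ if $\boldsymbol z|_{I_n}\notin H^{\mu_n+1}(I_n)^{2d}$, and $C$ depends only on an upper bound for the norms $\|P\|_\infty,\|L\|_\infty,\|K\|_\infty$ (maximal absolute row sums). -/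

import Mathlib

open MeasureTheory Set Filter Topology

noncomputable section

namespace TimeDG

/-! ### Sobolev spaces on an interval -/

section Sobolev

variable {E : Type*} [NormedAddCommGroup E] [NormedSpace ℝ E]

/-- `g` is the `k`-th weak derivative of `f` on the open interval `(a, b)`: both are locally
integrable there and `∫ φ⁽ᵏ⁾ f = (-1)ᵏ ∫ φ g` for every smooth `φ` with compact support in
`(a, b)`. -/
def IsWeakDeriv (k : ℕ) (a b : ℝ) (f g : ℝ → E) : Prop :=
  LocallyIntegrableOn f (Ioo a b) volume ∧ LocallyIntegrableOn g (Ioo a b) volume ∧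
    ∀ φ : ℝ → ℝ, ContDiff ℝ (⊤ : ℕ∞) φ → HasCompactSupport φ → tsupport φ ⊆ Ioo a b →
      ∫ x in Ioo a b, iteratedDeriv k φ x • f x = (-1 : ℝ) ^ k • ∫ x in Ioo a b, φ x • g x

/-- `f ∈ Hᵏ(a, b)`: all weak derivatives of order `0, …, k` exist and lie in `L²(a, b)`. -/
def MemSobolev (k : ℕ) (a b : ℝ) (f : ℝ → E) : Prop :=
  ∃ g : ℕ → ℝ → E, ∀ j ≤ k, IsWeakDeriv j a b f (g j) ∧
    MemLp (g j) 2 (volume.restrict (Ioo a b))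

/-- The norm `(∑_{j ≤ k} ‖f⁽ʲ⁾‖²_{L²(a,b)})^{1/2}` of `Hᵏ(a, b)`, with the value `∞` exactly when
`f` is not in `Hᵏ(a, b)`. Weak derivatives are unique up to null sets, so the
infimum is over families which all give the same value; it is `∞` if there is no such family. -/
def sobolevNorm (k : ℕ) (a b : ℝ) (f : ℝ → E) : ENNReal :=
  ⨅ (g : ℕ → ℝ → E) (_ : ∀ j ≤ k, IsWeakDeriv j a b f (g j)),
    (∑ j ∈ Finset.range (k + 1), eLpNorm (g j) 2 (volume.restrict (Ioo a b)) ^ 2) ^ (1 / 2 : ℝ)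

end Sobolev

/-! ### Vectors and matrices -/

/-- The state space `ℝ^{2d}` of the pairs `[u, w]`, with the Euclidean norm. -/
abbrev State (d : ℕ) : Type := EuclideanSpace ℝ (Fin d ⊕ Fin d)

/-- The block matrices of size `2d`. -/
abbrev BlockMat (d : ℕ) : Type := Matrix (Fin d ⊕ Fin d) (Fin d ⊕ Fin d) ℝ

/-- The pair `[u, w] ∈ ℝ^{2d}`. -/
def pair {d : ℕ} (u w : EuclideanSpace ℝ (Fin d)) : State d :=
  WithLp.toLp 2 (Sum.elim u.ofLp w.ofLp)

/-- The matrix-vector product `B x`. -/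
def act {d : ℕ} (B : BlockMat d) (x : State d) : State d :=
  WithLp.toLp 2 (B.mulVec x.ofLp)

/-- The norm `‖B‖_∞ = max_i ∑_j |b_{ij}|`. -/
def infNorm {d : ℕ} (B : Matrix (Fin d) (Fin d) ℝ) : ℝ := ⨆ i, ∑ j, |B i j|

section Sqrt

open scoped MatrixOrder

/-- The positive semidefinite square root of a positive semidefinite matrix. -/
def msqrt {n : Type*} [Fintype n] [DecidableEq n] (B : Matrix n n ℝ) : Matrix n n ℝ :=
  CFC.sqrt B

end Sqrt

variable {d : ℕ}

/-- `K̃ = [K, 0; 0, P]`. -/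
def Ktilde (P K : Matrix (Fin d) (Fin d) ℝ) : BlockMat d := Matrix.fromBlocks K 0 0 P

/-- `A = [0, -K; K, L]`. -/
def Amat (L K : Matrix (Fin d) (Fin d) ℝ) : BlockMat d := Matrix.fromBlocks 0 (-K) K L

/-- `L̃ = [0, 0; 0, L^{1/2}]`. -/
def Ltilde (L : Matrix (Fin d) (Fin d) ℝ) : BlockMat d := Matrix.fromBlocks 0 0 0 (msqrt L)

/-! ### The continuous problem -/

/-- `z` (through its continuous representative) is the solution in `H¹(0, T)` of
`K̃ ż + A z = [0, f]` on `(0, T]`, `z(0) = [u₀, u₁]`. -/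
structure IsSolution (P L K : Matrix (Fin d) (Fin d) ℝ) (f : ℝ → EuclideanSpace ℝ (Fin d))
    (u₀ u₁ : EuclideanSpace ℝ (Fin d)) (T : ℝ) (z : ℝ → State d) : Prop where
  cont : ContinuousOn z (Icc 0 T)
  init : z 0 = pair u₀ u₁
  eqn : ∃ z' : ℝ → State d, IsWeakDeriv 1 0 T z z' ∧
    MemLp z' 2 (volume.restrict (Ioo 0 T)) ∧
    ∀ᵐ τ ∂(volume.restrict (Ioo 0 T)),
      act (Ktilde P K) (z' τ) + act (Amat L K) (z τ) = pair 0 (f τ)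

/-! ### The discontinuous Galerkin method -/

/-- `0 = t₀ < t₁ < ⋯ < t_N = T`. Only the values `t 0, …, t N` matter; for `n < N`, the time
slab number `n + 1` is `(t n, t (n + 1)]`. -/
structure IsPartition (T : ℝ) (N : ℕ) (t : ℕ → ℝ) : Prop where
  zero : t 0 = 0
  last : t N = T
  lt : ∀ n < N, t n < t (n + 1)

/-- `v` is a piecewise polynomial: on the slab `(t n, t (n + 1)]` each component of `v`
is a polynomial of degree at most `r n`. -/
def IsPiecewisePoly (N : ℕ) (t : ℕ → ℝ) (r : ℕ → ℕ) (v : ℝ → State d) : Prop :=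
  ∀ n < N, ∃ p : Fin d ⊕ Fin d → Polynomial ℝ, (∀ i, (p i).natDegree ≤ r n) ∧
    ∀ τ ∈ Ioc (t n) (t (n + 1)), ∀ i, v τ i = (p i).eval τ

/-- The trace `v(τ⁺)`. -/
def tracePlus (v : ℝ → State d) (τ : ℝ) : State d := Function.rightLim v τ

/-- The trace `v(τ⁻)`. -/
def traceMinus (v : ℝ → State d) (τ : ℝ) : State d := Function.leftLim v τ

/-- The jump `[v] = v(τ⁺) - v(τ⁻)` at the time `τ`. -/
def jump (v : ℝ → State d) (τ : ℝ) : State d := tracePlus v τ - traceMinus v τ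

/-- The bilinear form `𝒜(z, v)`, for piecewise polynomials (so that `deriv z` is the derivative
inside each slab). -/
def formA (P L K : Matrix (Fin d) (Fin d) ℝ) (N : ℕ) (t : ℕ → ℝ) (z v : ℝ → State d) : ℝ :=
  (∑ n ∈ Finset.range N,
    ((∫ τ in Ioc (t n) (t (n + 1)), inner ℝ (act (Ktilde P K) (deriv z τ)) (v τ)) +
      ∫ τ in Ioc (t n) (t (n + 1)), inner ℝ (act (Amat L K) (z τ)) (v τ))) +
    (∑ n ∈ Finset.Ico 1 N, inner ℝ (act (Ktilde P K) (jump z (t n))) (tracePlus v (t n))) +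
    inner ℝ (act (Ktilde P K) (tracePlus z 0)) (tracePlus v 0)

/-- The linear functional `ℱ(v)`. -/
def formF (P K : Matrix (Fin d) (Fin d) ℝ) (f : ℝ → EuclideanSpace ℝ (Fin d))
    (u₀ u₁ : EuclideanSpace ℝ (Fin d)) (N : ℕ) (t : ℕ → ℝ) (v : ℝ → State d) : ℝ :=
  (∑ n ∈ Finset.range N, ∫ τ in Ioc (t n) (t (n + 1)), inner ℝ (pair 0 (f τ)) (v τ)) +
    inner ℝ (act (Ktilde P K) (pair u₀ u₁)) (tracePlus v 0)

/-- `zDG` is the discontinuous Galerkin approximation: it is piecewise polynomial and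
`𝒜(zDG, v) = ℱ(v)` for all piecewise polynomials `v` of the same degrees. -/
structure IsDGSolution (P L K : Matrix (Fin d) (Fin d) ℝ) (f : ℝ → EuclideanSpace ℝ (Fin d))
    (u₀ u₁ : EuclideanSpace ℝ (Fin d)) (N : ℕ) (t : ℕ → ℝ) (r : ℕ → ℕ)
    (zDG : ℝ → State d) : Prop where
  mem : IsPiecewisePoly N t r zDG
  eqn : ∀ v : ℝ → State d, IsPiecewisePoly N t r v →
    formA P L K N t zDG v = formF P K f u₀ u₁ N t v

/-- The energy norm: the square root of
`∑ₙ ‖L̃ e‖²_{L²(Iₙ)} + ½ (K̃^{1/2} e(0⁺))² + ½ ∑_{n=1}^{N-1} (K̃^{1/2} [e]ₙ)² + ½ (K̃^{1/2} e(T⁻))²`. -/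
def energyNorm (P L K : Matrix (Fin d) (Fin d) ℝ) (T : ℝ) (N : ℕ) (t : ℕ → ℝ)
    (e : ℝ → State d) : ℝ :=
  Real.sqrt
    ((∑ n ∈ Finset.range N, ∫ τ in Ioc (t n) (t (n + 1)), ‖act (Ltilde L) (e τ)‖ ^ 2) +
      1 / 2 * ‖act (msqrt (Ktilde P K)) (tracePlus e 0)‖ ^ 2 +
      1 / 2 * (∑ n ∈ Finset.Ico 1 N, ‖act (msqrt (Ktilde P K)) (jump e (t n))‖ ^ 2) +
      1 / 2 * ‖act (msqrt (Ktilde P K)) (traceMinus e T)‖ ^ 2)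

/-- The factor `(Δt / 2)^{μ + 1/2} ((r + 2) (r - μ)! / (r + μ)!)^{1/2}` (used with `μ ≤ r`). -/
def hpFactor (Δt : ℝ) (r μ : ℕ) : ℝ :=
  (Δt / 2) ^ ((μ : ℝ) + 1 / 2) *
    Real.sqrt (((r : ℝ) + 2) * ((Nat.factorial (r - μ) : ℝ) / (Nat.factorial (r + μ) : ℝ)))

end TimeDG

end

noncomputable section

namespace TimeDG

/-! ### Legendre polynomials on an interval -/

section Legendre

open Polynomial

/-! Let `w` be the slabwise `L²` projection of `z` onto the discrete space, `η = z - w` the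
projection error and `θ = w - z_DG` the discrete error. Test the scheme with `θ`. Since `θ` and `θ̇`
are polynomials of degree at most `r_n` on each slab, `η` is orthogonal to everything it meets in
the volume integrals: the term with `A` vanishes, and the term with `K̃` reduces after integration
by parts to traces of `η`. The off-diagonal blocks of `A` cancel in the quadratic form and the `K̃`
terms telescope, so that, by the continuity of `z`, `|||θ|||² = ∑ K̃ η(t_n⁻)·[θ]_n - K̃
η(T⁻)·θ(T⁻)`. Young's inequality absorbs `θ` (`trace_identity`, `brokenEnergy_le_of_isDGSolution`).
No Gronwall argument occurs, so the constant does not depend on `T`, on `N` or on the partition.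
Hence the error is controlled by the end point values and the `L²` norm of `η` on the slabs, and the
matrices enter only through their row sums (`sum_quadratic_le`, `energyNorm_error_le`).

It remains to approximate a scalar function `u` on `[a, b]`, with `H = (b - a) / 2`. Put `ω = (x -
a)(b - x)` and let `P_n` be the Legendre polynomials. The identity `(ω^{k+1} P_n^{(k+1)})' = -(n -
k)(n + k + 1) ω^k P_n^{(k)}` (`derivative_bubble_pow_mul`), used in `k` integrations by parts, gives
`∫ ω^k P_n^{(k)} u^{(k)} = (n + k)!/(n - k)! ∫ P_n u` (`IsDerivChain.moment`). With `ω ≤ H²` and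
Cauchy-Schwarz this bounds the Legendre tail of `u` (`integral_sub_polyProj_sq_le`) and single
Legendre moments (`sq_integral_legendre_mul_le`). The end point errors are half sums and half
differences, up to sign, of the moments of `u'` against `P_r` and `P_{r+1}` (`eval_sub_polyProj`).
Both estimates together give the factor `H^{2μ+1} (r - μ)!/(r + μ)!` for the squared error
(`polyProj_error_le`). -/

/-- The weight `(x - a) (b - x)` as a polynomial. -/
def bubble (a b : ℝ) : ℝ[X] := (X - C a) * (C b - X)

/-- The Legendre polynomial of degree `n` on `[a, b]`, with value `1` at `b`. -/
def legendre (a b : ℝ) (n : ℕ) : ℝ[X] :=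
  C (1 / (n.factorial * (b - a) ^ n)) * derivative^[n] (((X - C a) * (X - C b)) ^ n)

/-- For a quadratic `R`, the power `y = R ^ n` satisfies `R y' = n R' y`. Differentiating this `m +
1` times leaves only three terms, because `R''` is constant. -/
theorem iterate_derivative_pow_ode (R S : ℝ[X]) (hR : derivative R = S) (hS : derivative S = 2)
    (n m : ℕ) :
    R * derivative^[m + 2] (R ^ n) + ((m : ℝ[X]) + 1 - n) * S * derivative^[m + 1] (R ^ n) +
      ((m : ℝ[X]) + 1) * (m - 2 * n) * derivative^[m] (R ^ n) = 0 := by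
  have h0 : R * derivative (R ^ n) = n * S * R ^ n := by
    rcases n with _ | n
    · simp
    · rw [derivative_pow_succ, hR]; simp; ring
  induction m with
  | zero =>
    have h1 := congrArg derivative h0
    simp only [derivative_mul, hR, hS, derivative_natCast] at h1
    simp only [Function.iterate_succ, Function.iterate_zero, Function.comp, id, zero_add,
      Nat.cast_zero]
    linear_combination h1
  | succ m ih =>
    have h1 := congrArg derivative ih
    simp only [derivative_mul, derivative_add, derivative_sub, hR, hS, derivative_natCast,
      derivative_zero, derivative_one, ← Function.iterate_succ_apply' derivative,
      derivative_ofNat] at h1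
    push_cast
    linear_combination h1

theorem derivative_bubble_pow_mul (a b : ℝ) (n k : ℕ) :
    derivative (bubble a b ^ (k + 1) * derivative^[k + 1] (legendre a b n)) =
      C (-(((n : ℝ) - k) * (n + k + 1))) *
        (bubble a b ^ k * derivative^[k] (legendre a b n)) := by
  -- `P_n^{(k)}` is a multiple of the derivative of order `n + k` of `R ^ n`, so the relation is
  -- needed at `m = n + k`; its coefficients become `k + 1` and `-(n - k)(n + k + 1)`.
  have key := iterate_derivative_pow_ode ((X - C a) * (X - C b)) ((X - C b) + (X - C a))
    (by simp) (by simp; norm_num) n (n + k)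
  have hb : bubble a b = -((X - C a) * (X - C b)) := by unfold bubble; ring
  have hit : ∀ j, derivative^[j] (legendre a b n) = C (1 / (n.factorial * (b - a) ^ n)) *
      derivative^[n + j] (((X - C a) * (X - C b)) ^ n) := by
    intro j
    rw [legendre, iterate_derivative_C_mul, ← Function.iterate_add_apply, add_comm]
  have hd : derivative (bubble a b) = -((X - C b) + (X - C a)) := by rw [hb]; simp
  rw [hit, hit, derivative_mul, derivative_pow_succ, hd, derivative_mul, derivative_C,
    ← Function.iterate_succ_apply' derivative, hb]
  rw [show n + k + 2 = (n + (k + 1)).succ by omega, show n + k + 1 = n + (k + 1) by omega] at key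
  simp only [map_neg, map_mul, map_sub, map_add, map_natCast, map_one] at key ⊢
  push_cast at key ⊢
  generalize (X - C a) * (X - C b) = R at *
  linear_combination ((-1) ^ (k + 1) * R ^ k * C (1 / (n.factorial * (b - a) ^ n))) * key

theorem natDegree_legendre_le (a b : ℝ) (n : ℕ) : (legendre a b n).natDegree ≤ n := by
  refine (natDegree_C_mul_le _ _).trans ((natDegree_iterate_derivative _ _).trans ?_)
  have : (((X - C a) * (X - C b)) ^ n).natDegree ≤ n * 2 := by
    refine natDegree_pow_le_of_le n ?_
    compute_degree
  omega

theorem coeff_legendre_ne_zero {a b : ℝ} (hab : a < b) (n : ℕ) :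
    (legendre a b n).coeff n ≠ 0 := by
  have hm : (((X - C a) * (X - C b)) ^ n : ℝ[X]).Monic :=
    ((monic_X_sub_C a).mul (monic_X_sub_C b)).pow n
  have hdeg : (((X - C a) * (X - C b)) ^ n : ℝ[X]).natDegree = n + n := by
    rw [((monic_X_sub_C a).mul (monic_X_sub_C b)).natDegree_pow,
      (monic_X_sub_C a).natDegree_mul (monic_X_sub_C b)]
    simp; ring
  have hc : (((X - C a) * (X - C b)) ^ n : ℝ[X]).coeff (n + n) = 1 := by
    rw [← hdeg]; exact hm
  rw [legendre, coeff_C_mul, coeff_iterate_derivative, hc]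
  have h1 : (b - a) ^ n ≠ 0 := pow_ne_zero _ (sub_pos.2 hab).ne'
  have h2 : (n + n).descFactorial n ≠ 0 := by
    rw [Ne, Nat.descFactorial_eq_zero_iff_lt]; omega
  have h3 : (n.factorial : ℝ) ≠ 0 := by positivity
  simp only [nsmul_eq_mul, mul_one]
  refine mul_ne_zero (one_div_ne_zero (mul_ne_zero h3 h1)) (by exact_mod_cast h2)

/-- The Legendre polynomials up to degree `n` span the polynomials of degree at most `n`. -/
theorem exists_eq_sum_legendre {a b : ℝ} (hab : a < b) {n : ℕ} {p : ℝ[X]} (hp : p.natDegree ≤ n) :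
    ∃ c : ℕ → ℝ, p = ∑ i ∈ Finset.range (n + 1), C (c i) * legendre a b i := by
  induction n generalizing p with
  | zero =>
    refine ⟨fun _ => p.coeff 0, ?_⟩
    rw [eq_C_of_natDegree_le_zero hp]
    simp [legendre]
  | succ n ih =>
    set l := (legendre a b (n + 1)).coeff (n + 1) with hl
    have hl0 : l ≠ 0 := coeff_legendre_ne_zero hab (n + 1)
    obtain ⟨c, hc⟩ := ih (p := p - C (p.coeff (n + 1) / l) * legendre a b (n + 1)) (by
      rw [natDegree_le_iff_coeff_eq_zero]
      intro m hm
      rw [coeff_sub, coeff_C_mul]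
      rcases (Nat.succ_le_of_lt hm).eq_or_lt with h | h
      · rw [← h, ← hl]; field_simp; simp
      · rw [coeff_eq_zero_of_natDegree_lt (hp.trans_lt h),
          coeff_eq_zero_of_natDegree_lt ((natDegree_legendre_le a b _).trans_lt h)]; simp)
    refine ⟨fun i => if i = n + 1 then p.coeff (n + 1) / l else c i, ?_⟩
    rw [Finset.sum_range_succ]
    dsimp only
    rw [if_pos rfl]
    rw [Finset.sum_congr rfl (g := fun i => C (c i) * legendre a b i), ← hc]
    · ring
    · intro i hi
      rw [Finset.mem_range] at hi
      rw [if_neg (by omega)]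

/-- In the Leibniz expansion every term in which some derivative falls on `g` keeps a factor `X - C
t` and vanishes at `t`. This yields the end point values of the Legendre polynomials from the
Rodrigues formula. -/
theorem eval_iterate_derivative_X_sub_C_pow_mul (t : ℝ) (n : ℕ) (g : ℝ[X]) :
    (derivative^[n] ((X - C t) ^ n * g)).eval t = n.factorial * g.eval t := by
  rw [iterate_derivative_mul, eval_finsetSum,
    Finset.sum_eq_single_of_mem 0 (Finset.mem_range.mpr n.succ_pos)]
  · rw [n.choose_zero_right, one_smul, eval_mul, Nat.sub_zero, iterate_derivative_X_sub_pow_self]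
    simp
  · intro k hk hk0
    rw [iterate_derivative_X_sub_pow, eval_smul, eval_mul, eval_smul, eval_pow,
      Nat.sub_sub_self (Finset.mem_range_succ_iff.mp hk), eval_sub, eval_X, eval_C, sub_self,
      zero_pow hk0, smul_zero, zero_mul, smul_zero]

theorem eval_legendre_right {a b : ℝ} (hab : a < b) (n : ℕ) : (legendre a b n).eval b = 1 := by
  have h1 : (b - a) ^ n ≠ 0 := pow_ne_zero _ (sub_pos.2 hab).ne'
  have h3 : (n.factorial : ℝ) ≠ 0 := by positivity
  rw [legendre, mul_pow, mul_comm ((X - C a) ^ n), eval_mul,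
    eval_iterate_derivative_X_sub_C_pow_mul]
  simp
  field_simp

theorem eval_legendre_left {a b : ℝ} (hab : a < b) (n : ℕ) :
    (legendre a b n).eval a = (-1) ^ n := by
  have h1 : (b - a) ^ n ≠ 0 := pow_ne_zero _ (sub_pos.2 hab).ne'
  have h3 : (n.factorial : ℝ) ≠ 0 := by positivity
  rw [legendre, mul_pow, eval_mul, eval_iterate_derivative_X_sub_C_pow_mul]
  simp
  rw [show a - b = -1 * (b - a) by ring, mul_pow]
  field_simp

/-! ### Orthogonality and normalisation of the Legendre polynomials -/

theorem eval_bubble (a b x : ℝ) : (bubble a b).eval x = (x - a) * (b - x) := by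
  simp [bubble]

theorem intervalIntegrable_eval (p : ℝ[X]) (a b : ℝ) :
    IntervalIntegrable (fun x => p.eval x) volume a b :=
  (p.continuous).intervalIntegrable a b

theorem integral_eval_derivative (p : ℝ[X]) (a b : ℝ) :
    ∫ x in a..b, (derivative p).eval x = p.eval b - p.eval a :=
  intervalIntegral.integral_eq_sub_of_hasDerivAt (fun x _ => p.hasDerivAt x)
    (intervalIntegrable_eval _ _ _)

/-- The weight vanishes at both end points, so the derivative of `ω P_n' q` has integral zero; the
Legendre equation `(ω P_n')' = -n (n + 1) P_n` evaluates one half of it. -/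
theorem integral_legendre_derivative (a b : ℝ) (n : ℕ) (q : ℝ[X]) :
    ∫ x in a..b, (bubble a b * derivative (legendre a b n) * derivative q).eval x =
      n * (n + 1) * ∫ x in a..b, (legendre a b n * q).eval x := by
  have h := derivative_bubble_pow_mul a b n 0
  have h2 := integral_eval_derivative (bubble a b * derivative (legendre a b n) * q) a b
  simp only [zero_add, pow_one, Function.iterate_one, pow_zero, one_mul, Function.iterate_zero,
    id] at h
  rw [derivative_mul, h] at h2
  simp only [eval_add] at h2
  rw [intervalIntegral.integral_add (intervalIntegrable_eval _ _ _)
    (intervalIntegrable_eval _ _ _)] at h2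
  simp only [eval_mul, eval_bubble, mul_assoc, sub_self, zero_mul, mul_zero, eval_C,
    intervalIntegral.integral_const_mul, Nat.cast_zero, sub_zero, add_zero] at h2 ⊢
  linarith

/-- Eigenfunctions of a symmetric operator with different eigenvalues `n (n + 1)` and `m (m + 1)`.
-/
theorem integral_legendre_mul_legendre (a b : ℝ) {n m : ℕ} (hnm : n ≠ m) :
    ∫ x in a..b, (legendre a b n * legendre a b m).eval x = 0 := by
  have h1 := integral_legendre_derivative a b n (legendre a b m)
  have h2 := integral_legendre_derivative a b m (legendre a b n)
  rw [show bubble a b * derivative (legendre a b m) * derivative (legendre a b n) =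
    bubble a b * derivative (legendre a b n) * derivative (legendre a b m) by ring, h1,
    mul_comm (legendre a b m)] at h2
  have h3 : ((n : ℝ) * (n + 1) - m * (m + 1)) ≠ 0 := by
    have : ((n : ℝ) - m) * (n + m + 1) ≠ 0 :=
      mul_ne_zero (sub_ne_zero.2 (by exact_mod_cast hnm)) (by positivity)
    intro h; apply this; linarith
  have h4 := sub_eq_zero.2 h2
  rw [← sub_mul] at h4
  exact (mul_eq_zero.1 h4).resolve_left h3

theorem integral_mul_legendre_eq_zero {a b : ℝ} (hab : a < b) {n : ℕ} {q : ℝ[X]}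
    (hq : q.natDegree < n) : ∫ x in a..b, (q * legendre a b n).eval x = 0 := by
  obtain ⟨c, hc⟩ := exists_eq_sum_legendre hab le_rfl (p := q)
  rw [hc, Finset.sum_mul]
  simp only [eval_finsetSum]
  rw [intervalIntegral.integral_finsetSum (fun i _ => intervalIntegrable_eval _ _ _)]
  refine Finset.sum_eq_zero fun i hi => ?_
  have : i ≠ n := by rw [Finset.mem_range] at hi; omega
  have h := integral_legendre_mul_legendre a b this
  simp only [mul_assoc]
  simp only [eval_mul, eval_C, intervalIntegral.integral_const_mul] at h ⊢
  rw [h, mul_zero]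

/-- Integrate the derivative of `(x - a) P_n²`. In `(x - a) P_n' - n P_n` the leading terms cancel,
so it is orthogonal to `P_n`, and the integral equals `(2 n + 1) ∫ P_n²`; the boundary value is `b -
a` because `P_n` is `1` at `b`. -/
theorem integral_legendre_sq {a b : ℝ} (hab : a < b) (n : ℕ) :
    ∫ x in a..b, (legendre a b n * legendre a b n).eval x = (b - a) / (2 * n + 1) := by
  set p := legendre a b n with hp
  set q : ℝ[X] := (X - C a) * derivative p - C (n : ℝ) * p with hq
  have hdp : (derivative p).natDegree ≤ n - 1 :=
    (natDegree_derivative_le p).trans (Nat.sub_le_sub_right (natDegree_legendre_le a b n) 1)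
  have hqd : ∫ x in a..b, (q * p).eval x = 0 := by
    rcases Nat.eq_zero_or_pos n with h0 | h0
    · have : derivative p = 0 := derivative_of_natDegree_zero (by
        have : p.natDegree ≤ n := natDegree_legendre_le a b n
        omega)
      simp [hq, this, h0]
    · refine integral_mul_legendre_eq_zero hab ?_
      suffices q.natDegree ≤ n - 1 by omega
      rw [natDegree_le_iff_coeff_eq_zero]
      intro m hm
      obtain ⟨m, rfl⟩ : ∃ k, m = k + 1 := ⟨m - 1, by omega⟩
      rw [hq, coeff_sub, sub_mul, coeff_sub, coeff_X_mul, coeff_C_mul, coeff_C_mul,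
        coeff_eq_zero_of_natDegree_lt (p := derivative p) (n := m + 1) (by omega),
        coeff_derivative]
      rcases Nat.lt_or_ge n (m + 1) with h | h
      · rw [coeff_eq_zero_of_natDegree_lt (p := p)
          ((natDegree_legendre_le a b n).trans_lt h)]; simp
      · have : n = m + 1 := by omega
        rw [this]; push_cast; ring
  have h2 := integral_eval_derivative ((X - C a) * (p * p)) a b
  have h3 : derivative ((X - C a) * (p * p)) = C (2 * n + 1 : ℝ) * (p * p) + C 2 * (q * p) := by
    rw [hq]; simp only [derivative_mul, derivative_sub, derivative_X, derivative_C, map_add,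
      map_mul, map_natCast, map_ofNat, map_one]; ring
  rw [h3] at h2
  simp only [eval_add] at h2
  rw [intervalIntegral.integral_add (intervalIntegrable_eval _ _ _)
    (intervalIntegrable_eval _ _ _)] at h2
  simp only [eval_mul (p := C _), eval_C, intervalIntegral.integral_const_mul, hqd] at h2
  simp only [eval_mul (p := X - C a), eval_sub, eval_X, eval_C, sub_self, zero_mul] at h2
  rw [eval_mul, hp, eval_legendre_right hab] at h2
  rw [hp, eq_div_iff (by positivity)]
  linarith

end Legendre

end TimeDG

end

noncomputable section

namespace TimeDG

/-! ### Weak derivatives in one variable -/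

section WeakDeriv

open scoped ContDiff

/-- The primitive starting at `a` vanishes to the left of the support of `ψ`, and to the right of it
because the mean is zero. The support is compact, so its extreme points `c` and `e` lie strictly
inside the interval. -/
theorem exists_primitive_of_integral_eq_zero {a b : ℝ} {ψ : ℝ → ℝ}
    (hψ : ContDiff ℝ ∞ ψ) (hc : HasCompactSupport ψ) (hs : tsupport ψ ⊆ Ioo a b)
    (h0 : ∫ x, ψ x = 0) :
    ∃ φ : ℝ → ℝ, ContDiff ℝ ∞ φ ∧ HasCompactSupport φ ∧ tsupport φ ⊆ Ioo a b ∧ deriv φ = ψ := by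
  have hcont : Continuous ψ := hψ.continuous
  have hint : Integrable ψ := hcont.integrable_of_hasCompactSupport hc
  set φ : ℝ → ℝ := fun x => ∫ y in a..x, ψ y with hφ
  have hder : ∀ x, HasDerivAt φ (ψ x) x := fun x =>
    intervalIntegral.integral_hasDerivAt_right (hcont.intervalIntegrable _ _)
      (hcont.stronglyMeasurableAtFilter _ _) hcont.continuousAt
  have hderiv : deriv φ = ψ := funext fun x => (hder x).deriv
  by_cases hne : (tsupport ψ).Nonempty
  · obtain ⟨c, hcm, hcl⟩ := hc.isCompact.exists_isLeast hne
    obtain ⟨e, hem, hel⟩ := hc.isCompact.exists_isGreatest hne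
    have hsub : tsupport ψ ⊆ Icc c e := fun x hx => ⟨hcl hx, hel hx⟩
    have hz : ∀ x, x ∉ Icc c e → ψ x = 0 := fun x hx =>
      image_eq_zero_of_notMem_tsupport fun h => hx (hsub h)
    have hac : a < c := (hs hcm).1
    have heb : e < b := (hs hem).2
    have hleft : ∀ x, x < c → φ x = 0 := by
      intro x hx
      refine intervalIntegral.integral_zero_ae (Filter.Eventually.of_forall fun y hy => hz y ?_)
      rintro ⟨h1, -⟩
      have : y ≤ max a x := hy.2
      exact absurd h1 (not_le.2 (this.trans_lt (max_lt hac hx)))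
    have hright : ∀ x, e < x → φ x = 0 := by
      intro x hx
      have : φ x = ∫ y, ψ y := by
        have hce : c ≤ e := hcl hem
        rw [hφ]
        dsimp only
        rw [intervalIntegral.integral_of_le (by linarith),
          setIntegral_eq_integral_of_forall_compl_eq_zero]
        intro y hy
        refine hz y fun h => hy ⟨by linarith [h.1], by linarith [h.2]⟩
      rw [this, h0]
    have hsupp : Function.support φ ⊆ Icc c e := by
      intro x hx
      by_contra h
      rcases not_and_or.1 h with h | h
      · exact hx (hleft x (not_le.1 h))
      · exact hx (hright x (not_le.1 h))
    have hts : tsupport φ ⊆ Icc c e := closure_minimal hsupp isClosed_Icc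
    refine ⟨φ, ?_, ?_, ?_, hderiv⟩
    · rw [contDiff_infty_iff_deriv, hderiv]
      exact ⟨fun x => (hder x).differentiableAt, hψ⟩
    · exact HasCompactSupport.of_support_subset_isCompact isCompact_Icc hsupp
    · exact hts.trans fun x hx => ⟨hac.trans_le hx.1, hx.2.trans_lt heb⟩
  · have h : ψ = 0 := by
      funext x
      exact image_eq_zero_of_notMem_tsupport fun hx => hne ⟨x, hx⟩
    refine ⟨0, contDiff_const, HasCompactSupport.zero, by simp [tsupport], ?_⟩
    rw [h]; funext x; simp

theorem integrable_test_mul {a b : ℝ} {f φ : ℝ → ℝ}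
    (hf : LocallyIntegrableOn f (Ioo a b)) (hφ : Continuous φ)
    (hc : HasCompactSupport φ) (hs : tsupport φ ⊆ Ioo a b) :
    Integrable (fun x => φ x * f x) := by
  have h1 : IntegrableOn f (tsupport φ) := hf.integrableOn_compact_subset hs hc.isCompact
  have h2 : IntegrableOn (fun x => φ x * f x) (tsupport φ) :=
    h1.continuousOn_mul hφ.continuousOn hc.isCompact
  rw [← integrableOn_iff_integrable_of_support_subset (s := tsupport φ)]
  · exact h2
  · exact fun x hx => subset_tsupport φ fun h => hx (by simp [h])

theorem setIntegral_test_mul {a b : ℝ} {f φ : ℝ → ℝ} (hs : tsupport φ ⊆ Ioo a b) :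
    ∫ x in Ioo a b, φ x * f x = ∫ x, φ x * f x := by
  refine setIntegral_eq_integral_of_forall_compl_eq_zero fun x hx => ?_
  rw [image_eq_zero_of_notMem_tsupport fun h => hx (hs h), zero_mul]

/-- The du Bois-Reymond lemma. -/
theorem ae_eq_const_of_integral_deriv_mul_eq_zero {a b : ℝ} (hab : a < b) {f : ℝ → ℝ}
    (hf : LocallyIntegrableOn f (Ioo a b))
    (h : ∀ φ : ℝ → ℝ, ContDiff ℝ ∞ φ → HasCompactSupport φ → tsupport φ ⊆ Ioo a b →
      ∫ x, deriv φ x * f x = 0) :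
    ∃ c : ℝ, ∀ᵐ x ∂(volume.restrict (Ioo a b)), f x = c := by
  -- Fix a bump `ρ₀` with positive integral `I`. Every test function `g` minus `((∫ g) / I) ρ₀` has
  -- mean zero, hence is the derivative of a test function; this forces the constant to be `(∫ ρ₀ f)
  -- / I`.
  obtain ⟨ρ₀, hρs, hρc, hρd, hρr, hρ1⟩ := exists_contDiff_tsupport_subset (n := ⊤)
    (Ioo_mem_nhds (show a < (a + b) / 2 by linarith) (show (a + b) / 2 < b by linarith))
  have hρpos : 0 < ∫ x, ρ₀ x := by
    refine hρd.continuous.integral_pos_of_hasCompactSupport_nonneg_nonzero hρc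
      (fun x => (hρr ⟨x, rfl⟩).1) (x := (a + b) / 2) (by rw [hρ1]; exact one_ne_zero)
  set I := ∫ x, ρ₀ x with hI
  have hρint := integrable_test_mul hf hρd.continuous hρc hρs
  refine ⟨(∫ x, ρ₀ x * f x) / I, ?_⟩
  set c := (∫ x, ρ₀ x * f x) / I with hcdef
  have hlc : LocallyIntegrableOn (fun x => f x - c) (Ioo a b) :=
    hf.sub ((locallyIntegrable_const c).locallyIntegrableOn _)
  have key := isOpen_Ioo.ae_eq_zero_of_integral_contDiff_smul_eq_zero hlc (by
    intro g hg hgc hgs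
    simp only [smul_eq_mul]
    have hgi : Integrable g := hg.continuous.integrable_of_hasCompactSupport hgc
    have hρi : Integrable ρ₀ := hρd.continuous.integrable_of_hasCompactSupport hρc
    have hgf := integrable_test_mul hf hg.continuous hgc hgs
    set m := (∫ x, g x) / I with hm
    have hsupp : tsupport (fun x => g x - m * ρ₀ x) ⊆ Ioo a b := by
      have h1 : tsupport (fun x => m * ρ₀ x) ⊆ Ioo a b :=
        (tsupport_mul_subset_right (f := fun _ => m) (g := ρ₀)).trans hρs
      exact (tsupport_sub g (fun x => m * ρ₀ x)).trans (union_subset hgs h1)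
    obtain ⟨φ, h1, h2, h3, h4⟩ := exists_primitive_of_integral_eq_zero (a := a) (b := b)
      (ψ := fun x => g x - m * ρ₀ x) (hg.sub (contDiff_const.mul hρd))
      (hgc.sub (hρc.mul_left (f := fun _ => m))) hsupp (by
        rw [integral_sub hgi (hρi.const_mul m), integral_const_mul, ← hI, hm]
        field_simp; simp)
    have h5 := h φ h1 h2 h3
    rw [h4] at h5
    have h6 : ∀ x, (g x - m * ρ₀ x) * f x = g x * f x - m * (ρ₀ x * f x) := fun x => by ring
    simp only [h6] at h5
    rw [integral_sub hgf (hρint.const_mul m), integral_const_mul] at h5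
    have h7 : ∀ x, g x * (f x - c) = g x * f x - c * g x := fun x => by ring
    simp only [h7]
    rw [integral_sub hgf (hgi.const_mul c), integral_const_mul, hcdef]
    rw [hm] at h5
    rw [← h5]
    ring)
  rw [ae_restrict_iff' measurableSet_Ioo]
  filter_upwards [key] with x hx hx'
  linarith [hx hx']

/-- Integration by parts against the primitive of an integrable function. -/
theorem integral_deriv_mul_primitive {a b : ℝ} {g φ : ℝ → ℝ}
    (hg : IntervalIntegrable g volume a b) (hφ : ContDiff ℝ 1 φ) :
    ∫ x in a..b, deriv φ x * (∫ y in a..x, g y) =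
      φ b * (∫ y in a..b, g y) - ∫ x in a..b, φ x * g x := by
  have h1 := hg.absolutelyContinuousOnInterval_intervalIntegral (c := a) left_mem_uIcc
  have h2 : AbsolutelyContinuousOnInterval φ a b :=
    hφ.contDiffOn.absolutelyContinuousOnInterval
  have h3 := h2.integral_mul_deriv_eq_deriv_mul h1
  have h4 : ∫ x in a..b, φ x * deriv (fun x => ∫ y in a..x, g y) x = ∫ x in a..b, φ x * g x := by
    refine intervalIntegral.integral_congr_ae ?_
    filter_upwards [hg.ae_hasDerivAt_integral] with x hx hx'
    rw [(hx (uIoc_subset_uIcc hx') a left_mem_uIcc).deriv]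
  rw [h4] at h3
  simp only [intervalIntegral.integral_same, mul_zero, sub_zero] at h3
  linarith

/-- A function with an integrable weak derivative is a primitive of that derivative. -/
theorem IsWeakDeriv.ae_eq_primitive {a b : ℝ} (hab : a < b) {v v' : ℝ → ℝ}
    (h : IsWeakDeriv 1 a b v v') (hv' : IntegrableOn v' (Ioo a b)) :
    ∃ c : ℝ, ∀ᵐ x ∂(volume.restrict (Ioo a b)), v x = c + ∫ y in a..x, v' y := by
  have hii : IntervalIntegrable v' volume a b := by
    rwa [intervalIntegrable_iff_integrableOn_Ioo_of_le hab.le]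
  have hGc : ContinuousOn (fun x => ∫ y in a..x, v' y) (Ioo a b) := by
    have := (hii.absolutelyContinuousOnInterval_intervalIntegral (c := a) left_mem_uIcc).continuousOn
    refine this.mono ?_
    rw [uIcc_of_le hab.le]
    exact Ioo_subset_Icc_self
  have hGl : LocallyIntegrableOn (fun x => ∫ y in a..x, v' y) (Ioo a b) :=
    hGc.locallyIntegrableOn measurableSet_Ioo
  -- Both `v` and the primitive of `v'` satisfy the same integration by parts against test
  -- functions, so their difference is annihilated by all derivatives of test functions.
  obtain ⟨c, hc⟩ := ae_eq_const_of_integral_deriv_mul_eq_zero hab (h.1.sub hGl) (by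
    intro φ h1 h2 h3
    have hφ0 : ∀ x, x ∉ Ioo a b → φ x = 0 := fun x hx =>
      image_eq_zero_of_notMem_tsupport fun h => hx (h3 h)
    have hds : tsupport (deriv φ) ⊆ Ioo a b :=
      (closure_minimal (support_deriv_subset) (isClosed_tsupport φ)).trans h3
    have hdc : HasCompactSupport (deriv φ) := h2.deriv
    have hdcont : Continuous (deriv φ) := h1.continuous_deriv (by simp)
    have e1 := h.2.2 φ h1 h2 h3
    simp only [iteratedDeriv_one, smul_eq_mul, pow_one] at e1
    rw [setIntegral_test_mul hds, setIntegral_test_mul h3] at e1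
    have e2 := integral_deriv_mul_primitive hii (h1.of_le (by simp))
    rw [intervalIntegral.integral_of_le hab.le, intervalIntegral.integral_of_le hab.le,
      intervalIntegral.integral_of_le hab.le, integral_Ioc_eq_integral_Ioo,
      integral_Ioc_eq_integral_Ioo, integral_Ioc_eq_integral_Ioo, hφ0 b (by simp),
      setIntegral_test_mul hds, setIntegral_test_mul h3] at e2
    have e3 : ∀ x, deriv φ x * (v - fun x => ∫ y in a..x, v' y) x =
        deriv φ x * v x - deriv φ x * ∫ y in a..x, v' y := fun x => by
      simp only [Pi.sub_apply]; ring
    simp only [e3]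
    rw [integral_sub (integrable_test_mul h.1 hdcont hdc hds)
      (integrable_test_mul hGl hdcont hdc hds), e1, e2]
    ring)
  refine ⟨c, ?_⟩
  filter_upwards [hc] with x hx
  simp only [Pi.sub_apply] at hx
  linarith

/-- Extends the defining identity from compactly supported `φ` to `φ` that merely vanishes at the
end points, as needed for powers of `ω` times polynomials. The unknown constant in the primitive is
harmless, since `∫ φ' = 0`. -/
theorem IsWeakDeriv.integral_deriv_mul {a b : ℝ} (hab : a < b) {v v' φ : ℝ → ℝ}
    (h : IsWeakDeriv 1 a b v v') (hv' : IntegrableOn v' (Ioo a b))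
    (hφ : ContDiff ℝ 1 φ) (ha : φ a = 0) (hb : φ b = 0) :
    ∫ x in a..b, deriv φ x * v x = - ∫ x in a..b, φ x * v' x := by
  obtain ⟨c, hc⟩ := h.ae_eq_primitive hab hv'
  have hii : IntervalIntegrable v' volume a b := by
    rwa [intervalIntegrable_iff_integrableOn_Ioo_of_le hab.le]
  have hGc := (hii.absolutelyContinuousOnInterval_intervalIntegral (c := a) left_mem_uIcc).continuousOn
  have hdc : Continuous (deriv φ) := hφ.continuous_deriv le_rfl
  have hdG : IntervalIntegrable (fun x => deriv φ x * ∫ y in a..x, v' y) volume a b :=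
    (hdc.continuousOn.mul hGc).intervalIntegrable
  have e : ∫ x in a..b, deriv φ x * v x =
      ∫ x in a..b, (c * deriv φ x + deriv φ x * ∫ y in a..x, v' y) := by
    rw [intervalIntegral.integral_of_le hab.le, intervalIntegral.integral_of_le hab.le,
      integral_Ioc_eq_integral_Ioo, integral_Ioc_eq_integral_Ioo]
    refine integral_congr_ae ?_
    filter_upwards [hc] with x hx
    rw [hx]; ring
  rw [e, intervalIntegral.integral_add ((hdc.intervalIntegrable a b).const_mul c)
    hdG, intervalIntegral.integral_const_mul,
    integral_deriv_mul_primitive hii hφ, hb,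
    intervalIntegral.integral_deriv_eq_sub (fun x _ => (hφ.differentiable one_ne_zero) x)
      (hdc.intervalIntegrable a b), ha, hb]
  ring

/-- The continuous representative of a function with an integrable weak derivative. -/
theorem IsWeakDeriv.eq_primitive {a b : ℝ} (hab : a < b) {v v' : ℝ → ℝ}
    (h : IsWeakDeriv 1 a b v v') (hv' : IntegrableOn v' (Ioo a b))
    (hc : ContinuousOn v (Icc a b)) :
    ∀ x ∈ Icc a b, v x = v a + ∫ y in a..x, v' y := by
  obtain ⟨c, hae⟩ := h.ae_eq_primitive hab hv'
  have hii : IntervalIntegrable v' volume a b := by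
    rwa [intervalIntegrable_iff_integrableOn_Ioo_of_le hab.le]
  have hGc := (hii.absolutelyContinuousOnInterval_intervalIntegral (c := a) left_mem_uIcc).continuousOn
  rw [uIcc_of_le hab.le] at hGc
  have hG' : ContinuousOn (fun x => c + ∫ y in a..x, v' y) (Icc a b) := continuousOn_const.add hGc
  have h1 : EqOn v (fun x => c + ∫ y in a..x, v' y) (Ioo a b) :=
    Measure.eqOn_open_of_ae_eq hae isOpen_Ioo (hc.mono Ioo_subset_Icc_self)
      (hG'.mono Ioo_subset_Icc_self)
  have h2 : EqOn v (fun x => c + ∫ y in a..x, v' y) (Icc a b) := by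
    refine h1.of_subset_closure hc hG' Ioo_subset_Icc_self ?_
    rw [closure_Ioo hab.ne]
  have h3 : v a = c := by simpa using h2 (left_mem_Icc.2 hab.le)
  intro x hx
  rw [h3]
  exact h2 hx

/-- The version with boundary terms. The values of `v` at the end points now matter, so the
representation is required everywhere on `[a, b]` and not only almost everywhere. -/
theorem integral_deriv_mul_of_eq_primitive {a b : ℝ} (hab : a ≤ b) {v v' φ : ℝ → ℝ}
    (hv' : IntervalIntegrable v' volume a b) (h : ∀ x ∈ Icc a b, v x = v a + ∫ y in a..x, v' y)
    (hφ : ContDiff ℝ 1 φ) :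
    ∫ x in a..b, deriv φ x * v x = φ b * v b - φ a * v a - ∫ x in a..b, φ x * v' x := by
  have hGc := (hv'.absolutelyContinuousOnInterval_intervalIntegral (c := a) left_mem_uIcc).continuousOn
  have hdc : Continuous (deriv φ) := hφ.continuous_deriv le_rfl
  have hdG : IntervalIntegrable (fun x => deriv φ x * ∫ y in a..x, v' y) volume a b :=
    (hdc.continuousOn.mul hGc).intervalIntegrable
  have e : ∫ x in a..b, deriv φ x * v x =
      ∫ x in a..b, (v a * deriv φ x + deriv φ x * ∫ y in a..x, v' y) := by
    refine intervalIntegral.integral_congr fun x hx => ?_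
    rw [uIcc_of_le hab] at hx
    rw [h x hx]; ring
  rw [e, intervalIntegral.integral_add ((hdc.intervalIntegrable a b).const_mul (v a))
    hdG, intervalIntegral.integral_const_mul,
    integral_deriv_mul_primitive hv' hφ, h b (right_mem_Icc.2 hab),
    intervalIntegral.integral_deriv_eq_sub (fun x _ => (hφ.differentiable one_ne_zero) x)
      (hdc.intervalIntegrable a b)]
  ring

/-- Test the identity of order `k` with `φ'`. A family in `sobolevNorm` relates each member to `u`
only; this relates consecutive members to each other. -/
theorem IsWeakDeriv.of_succ {k : ℕ} {a b : ℝ} {u g g' : ℝ → ℝ} (h : IsWeakDeriv k a b u g)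
    (h' : IsWeakDeriv (k + 1) a b u g') : IsWeakDeriv 1 a b g g' := by
  refine ⟨h.2.1, h'.2.1, fun φ h1 h2 h3 => ?_⟩
  have hds : tsupport (deriv φ) ⊆ Ioo a b :=
    (closure_minimal (support_deriv_subset) (isClosed_tsupport φ)).trans h3
  have e1 := h.2.2 (deriv φ) (contDiff_infty_iff_deriv.1 h1).2 h2.deriv hds
  have e2 := h'.2.2 φ h1 h2 h3
  rw [iteratedDeriv_succ'] at e2
  rw [e1] at e2
  rw [iteratedDeriv_one]
  simp only [smul_eq_mul] at *
  have h4 : ((-1 : ℝ) ^ k) * (-1) ^ k = 1 := by rw [← mul_pow]; norm_num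
  linear_combination ((-1 : ℝ) ^ k) * e2 - (∫ x in Ioo a b, deriv φ x * g x) * h4 -
    (∫ x in Ioo a b, φ x * g' x) * h4

theorem IsWeakDeriv.ae_eq_of_zero {a b : ℝ} {u g : ℝ → ℝ} (h : IsWeakDeriv 0 a b u g) :
    ∀ᵐ x ∂(volume.restrict (Ioo a b)), g x = u x := by
  have key := isOpen_Ioo.ae_eq_zero_of_integral_contDiff_smul_eq_zero (h.2.1.sub h.1) (by
    intro φ h1 h2 h3
    have e1 := h.2.2 φ h1 h2 h3
    simp only [iteratedDeriv_zero, smul_eq_mul, pow_zero, one_mul] at e1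
    rw [setIntegral_test_mul h3, setIntegral_test_mul h3] at e1
    have e3 : ∀ x, φ x • (g - u) x = φ x * g x - φ x * u x := fun x => by
      simp only [Pi.sub_apply, smul_eq_mul]; ring
    simp only [e3]
    rw [integral_sub (integrable_test_mul h.2.1 h1.continuous h2 h3)
      (integrable_test_mul h.1 h1.continuous h2 h3), e1, sub_self])
  rw [ae_restrict_iff' measurableSet_Ioo]
  filter_upwards [key] with x hx hx'
  exact sub_eq_zero.1 (hx hx')

theorem tsupport_iteratedDeriv_subset (φ : ℝ → ℝ) (k : ℕ) :
    tsupport (iteratedDeriv k φ) ⊆ tsupport φ := by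
  induction k with
  | zero => simp
  | succ k ih =>
    rw [iteratedDeriv_succ]
    exact (closure_minimal support_deriv_subset (isClosed_tsupport _)).trans ih

/-! ### Components of vector-valued weak derivatives -/

theorem LocallyIntegrableOn.apply_euclidean {ι : Type*} [Fintype ι] {s : Set ℝ}
    {f : ℝ → EuclideanSpace ℝ ι} (hf : LocallyIntegrableOn f s) (i : ι) :
    LocallyIntegrableOn (fun x => f x i) s := fun x hx => by
  obtain ⟨U, hU, h⟩ := hf x hx
  exact ⟨U, hU, (EuclideanSpace.proj i : EuclideanSpace ℝ ι →L[ℝ] ℝ).integrable_comp h⟩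

theorem smul_integrable_test {a b : ℝ} {ι : Type*} [Fintype ι] {f : ℝ → EuclideanSpace ℝ ι}
    {φ : ℝ → ℝ} (hf : LocallyIntegrableOn f (Ioo a b)) (hφ : Continuous φ)
    (hc : HasCompactSupport φ) (hs : tsupport φ ⊆ Ioo a b) :
    Integrable (fun x => φ x • f x) := by
  have h1 : IntegrableOn f (tsupport φ) := hf.integrableOn_compact_subset hs hc.isCompact
  have h2 : IntegrableOn (fun x => φ x • f x) (tsupport φ) :=
    h1.continuousOn_smul hφ.continuousOn hc.isCompact
  rw [← integrableOn_iff_integrable_of_support_subset (s := tsupport φ)]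
  · exact h2
  · exact fun x hx => subset_tsupport φ fun h => hx (by simp [h])

theorem IsWeakDeriv.apply {ι : Type*} [Fintype ι] {k : ℕ} {a b : ℝ}
    {u g : ℝ → EuclideanSpace ℝ ι} (h : IsWeakDeriv k a b u g) (i : ι) :
    IsWeakDeriv k a b (fun x => u x i) (fun x => g x i) := by
  refine ⟨LocallyIntegrableOn.apply_euclidean h.1 i, LocallyIntegrableOn.apply_euclidean h.2.1 i, ?_⟩
  intro φ h1 h2 h3
  have hks : tsupport (iteratedDeriv k φ) ⊆ Ioo a b :=
    (tsupport_iteratedDeriv_subset φ k).trans h3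
  have hkc : HasCompactSupport (iteratedDeriv k φ) :=
     HasCompactSupport.of_support_subset_isCompact h2.isCompact
      ((subset_tsupport _).trans (tsupport_iteratedDeriv_subset φ k))
  have hkcont : Continuous (iteratedDeriv k φ) := h1.continuous_iteratedDeriv k (by
    exact_mod_cast le_top)
  have e := congrArg (EuclideanSpace.proj i : EuclideanSpace ℝ ι →L[ℝ] ℝ) (h.2.2 φ h1 h2 h3)
  rw [map_smul, ← ContinuousLinearMap.integral_comp_comm _
    (smul_integrable_test h.1 hkcont hkc hks).integrableOn,
    ← ContinuousLinearMap.integral_comp_comm _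
    (smul_integrable_test h.2.1 h1.continuous h2 h3).integrableOn] at e
  simpa using e

end WeakDeriv

end TimeDG

end

noncomputable section

namespace TimeDG

/-! ### Approximation by the `L²` projection onto polynomials -/

section Projection

open Polynomial

/-- The eigenvalue products `(n + k)! / (n - k)!`. -/
def legendreFactor (n k : ℕ) : ℝ := ∏ i ∈ Finset.range k, ((n : ℝ) - i) * (n + i + 1)

theorem legendreFactor_mul_factorial {n k : ℕ} (hk : k ≤ n) :
    legendreFactor n k * ((n - k).factorial : ℝ) = ((n + k).factorial : ℝ) := by
  induction k with
  | zero => simp [legendreFactor]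
  | succ k ih =>
    have ih := ih (by omega)
    have h1 : n - k = (n - (k + 1)) + 1 := by omega
    rw [h1, Nat.factorial_succ] at ih
    rw [legendreFactor, Finset.prod_range_succ, ← legendreFactor,
      show n + (k + 1) = (n + k) + 1 by omega, Nat.factorial_succ]
    have h2 : ((n - (k + 1) + 1 : ℕ) : ℝ) = (n : ℝ) - k := by
      rw [← h1]; exact Nat.cast_sub (by omega)
    rw [Nat.cast_mul, h2] at ih
    push_cast
    linear_combination ((n : ℝ) + k + 1) * ih

theorem legendreFactor_pos {n k : ℕ} (hk : k ≤ n) : 0 < legendreFactor n k := by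
  refine Finset.prod_pos fun i hi => ?_
  have : (i : ℝ) < n := by exact_mod_cast (Finset.mem_range.1 hi).trans_le hk
  have : 0 < (n : ℝ) - i := by linarith
  positivity

theorem legendreFactor_mono {n m k : ℕ} (hk : k ≤ n) (hnm : n ≤ m) :
    legendreFactor n k ≤ legendreFactor m k := by
  have hnm' : (n : ℝ) ≤ m := by exact_mod_cast hnm
  refine Finset.prod_le_prod (fun i hi => ?_) fun i hi => ?_
  all_goals
    have : (i : ℝ) < n := by exact_mod_cast (Finset.mem_range.1 hi).trans_le hk
    have : 0 < (n : ℝ) - i := by linarith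
  · positivity
  · have : 0 ≤ (m : ℝ) - i := by linarith
    gcongr

/-- The additional factor `(n + 1 - k)(n + k + 2)` is at least `1`. This compares the bound with one
more derivative and one more degree to the target factor. -/
theorem legendreFactor_succ_ge {n k : ℕ} (hk : k ≤ n) :
    legendreFactor n k ≤ legendreFactor (n + 1) (k + 1) := by
  have h1 := legendreFactor_mono hk n.le_succ
  have h2 : legendreFactor (n + 1) (k + 1) =
      legendreFactor (n + 1) k * ((((n + 1 : ℕ) : ℝ) - k) * (((n + 1 : ℕ) : ℝ) + k + 1)) :=
    Finset.prod_range_succ _ _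
  have h3 : (k : ℝ) ≤ n := by exact_mod_cast hk
  have h4 : 1 ≤ (((n + 1 : ℕ) : ℝ) - k) * (((n + 1 : ℕ) : ℝ) + k + 1) := by
    push_cast
    have : (0 : ℝ) ≤ k := by positivity
    nlinarith
  rw [h2]
  have := legendreFactor_pos (hk.trans n.le_succ)
  nlinarith

/-- `v` is a chain of derivatives up to order `k`, as far as integration by parts against
polynomials vanishing at both end points is concerned. -/
def IsDerivChain (k : ℕ) (a b : ℝ) (v : ℕ → ℝ → ℝ) : Prop :=
  (∀ j < k, ∀ φ : ℝ[X], φ.eval a = 0 → φ.eval b = 0 →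
    ∫ x in a..b, (derivative φ).eval x * v j x = -∫ x in a..b, φ.eval x * v (j + 1) x)

/-- Each integration by parts has no boundary terms, because `ω ^ (k + 1)` vanishes at both ends,
and it produces one factor `(n - k)(n + k + 1)` through `derivative_bubble_pow_mul`. -/
theorem IsDerivChain.moment {k : ℕ} {a b : ℝ} {v : ℕ → ℝ → ℝ} (h : IsDerivChain k a b v) (n : ℕ) :
    ∫ x in a..b, (bubble a b ^ k * derivative^[k] (legendre a b n)).eval x * v k x =
      legendreFactor n k * ∫ x in a..b, (legendre a b n).eval x * v 0 x := by
  induction k with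
  | zero => simp [legendreFactor]
  | succ k ih =>
    have ih := ih (fun j hj => h j (by omega))
    have h1 := h k (by omega) (bubble a b ^ (k + 1) * derivative^[k + 1] (legendre a b n))
      (by simp [bubble]) (by simp [bubble])
    rw [derivative_bubble_pow_mul] at h1
    simp only [eval_mul (p := C _), eval_C, mul_assoc,
      intervalIntegral.integral_const_mul] at h1
    rw [ih] at h1
    rw [legendreFactor, Finset.prod_range_succ, ← legendreFactor]
    linarith

theorem contDiff_eval (p : ℝ[X]) (n : WithTop ℕ∞) : ContDiff ℝ n fun x => p.eval x := by
  simpa [Polynomial.coe_aeval_eq_eval] using p.contDiff_aeval (𝕜 := ℝ) n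

theorem integral_mul_derivative (p q : ℝ[X]) (a b : ℝ) :
    ∫ x in a..b, (derivative p).eval x * q.eval x =
      p.eval b * q.eval b - p.eval a * q.eval a - ∫ x in a..b, p.eval x * (derivative q).eval x := by
  have h := integral_eval_derivative (p * q) a b
  rw [derivative_mul] at h
  simp only [eval_add] at h
  rw [intervalIntegral.integral_add (intervalIntegrable_eval _ _ _)
    (intervalIntegrable_eval _ _ _)] at h
  simp only [eval_mul] at h
  linarith

/-- Makes the moment identity available for polynomials themselves, where it computes the weighted
norms `∫ ω^k (Q^{(k)})²`. -/
theorem isDerivChain_polynomial (k : ℕ) (a b : ℝ) (q : ℝ[X]) :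
    IsDerivChain k a b (fun j x => (derivative^[j] q).eval x) := by
  intro j _ φ ha hb
  rw [integral_mul_derivative, ha, hb]
  simp [Function.iterate_succ_apply', -Function.iterate_succ]

/-- The Cauchy-Schwarz inequality for interval integrals. -/
theorem sq_integral_mul_le {a b : ℝ} (hab : a ≤ b) {f g : ℝ → ℝ}
    (hf : IntervalIntegrable (fun x => f x ^ 2) volume a b)
    (hg : IntervalIntegrable (fun x => g x ^ 2) volume a b)
    (hfg : IntervalIntegrable (fun x => f x * g x) volume a b) :
    (∫ x in a..b, f x * g x) ^ 2 ≤ (∫ x in a..b, f x ^ 2) * ∫ x in a..b, g x ^ 2 := by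
  have h : ∀ s : ℝ, 0 ≤ (∫ x in a..b, f x ^ 2) * (s * s) + (2 * ∫ x in a..b, f x * g x) * s +
      ∫ x in a..b, g x ^ 2 := by
    intro s
    have h1 : ∫ x in a..b, (f x * s + g x) ^ 2 =
        (∫ x in a..b, f x ^ 2) * (s * s) + (2 * ∫ x in a..b, f x * g x) * s +
          ∫ x in a..b, g x ^ 2 := by
      have : ∀ x, (f x * s + g x) ^ 2 = (s * s) * f x ^ 2 + (2 * s) * (f x * g x) + g x ^ 2 :=
        fun x => by ring
      simp only [this]
      rw [intervalIntegral.integral_add ((hf.const_mul _).add (hfg.const_mul _)) hg,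
        intervalIntegral.integral_add (hf.const_mul _) (hfg.const_mul _),
        intervalIntegral.integral_const_mul, intervalIntegral.integral_const_mul]
      ring
    rw [← h1]
    exact intervalIntegral.integral_nonneg hab fun x _ => sq_nonneg _
  have := discrim_le_zero h
  unfold discrim at this
  nlinarith

theorem bubble_nonneg {a b x : ℝ} (hx : x ∈ Icc a b) : 0 ≤ (bubble a b).eval x := by
  rw [eval_bubble]; exact mul_nonneg (by linarith [hx.1]) (by linarith [hx.2])

theorem bubble_le (a b x : ℝ) : (bubble a b).eval x ≤ ((b - a) / 2) ^ 2 := by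
  rw [eval_bubble]; nlinarith [sq_nonneg (x - (a + b) / 2)]

/-- Cauchy-Schwarz with the weight `((x - a) (b - x))ᵏ`. -/
theorem sq_integral_bubble_mul_le {a b : ℝ} (hab : a ≤ b) (k : ℕ) (p : ℝ[X]) {g : ℝ → ℝ}
    (hg : IntervalIntegrable g volume a b)
    (hg2 : IntervalIntegrable (fun x => g x ^ 2) volume a b) :
    (∫ x in a..b, (bubble a b ^ k * p).eval x * g x) ^ 2 ≤
      ((b - a) / 2) ^ (2 * k) * (∫ x in a..b, (bubble a b ^ k * p).eval x * p.eval x) *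
        ∫ x in a..b, g x ^ 2 := by
  have h1 := sq_integral_mul_le hab (f := fun x => (bubble a b ^ k * p).eval x) (g := g)
    (((Polynomial.continuous _).pow 2).intervalIntegrable _ _) hg2
    (hg.continuousOn_mul (Polynomial.continuous _).continuousOn)
  refine h1.trans ?_
  refine mul_le_mul_of_nonneg_right ?_
    (intervalIntegral.integral_nonneg hab fun x _ => sq_nonneg _)
  rw [← intervalIntegral.integral_const_mul]
  refine intervalIntegral.integral_mono_on hab
    (((Polynomial.continuous _).pow 2).intervalIntegrable _ _)
    ((continuous_const.mul ((Polynomial.continuous _).mul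
      (Polynomial.continuous _))).intervalIntegrable _ _) fun x hx => ?_
  simp only [eval_mul, eval_pow]
  have h2 := bubble_nonneg hx
  -- Of the two powers of the weight one is replaced by its maximum; the other remains, so that the
  -- right side is again a quantity given by the moment identity.
  have h3 : (bubble a b).eval x ^ k ≤ ((b - a) / 2) ^ (2 * k) := by
    rw [pow_mul]; exact pow_le_pow_left₀ h2 (bubble_le a b x) k
  have h4 : 0 ≤ (bubble a b).eval x ^ k * p.eval x ^ 2 := by positivity
  calc ((bubble a b).eval x ^ k * p.eval x) ^ 2
      = (bubble a b).eval x ^ k * ((bubble a b).eval x ^ k * p.eval x ^ 2) := by ring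
    _ ≤ ((b - a) / 2) ^ (2 * k) * ((bubble a b).eval x ^ k * p.eval x ^ 2) :=
        mul_le_mul_of_nonneg_right h3 h4
    _ = _ := by ring

/-- The Legendre coefficients of `u` on `[a, b]`. -/
def legendreCoeff (a b : ℝ) (u : ℝ → ℝ) (i : ℕ) : ℝ :=
  (∫ x in a..b, (legendre a b i).eval x * u x) /
    ∫ x in a..b, (legendre a b i * legendre a b i).eval x

/-- The partial sum of the Legendre expansion of `u` over the indices in `s`. -/
def legendreSum (a b : ℝ) (u : ℝ → ℝ) (s : Finset ℕ) : ℝ[X] :=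
  ∑ i ∈ s, C (legendreCoeff a b u i) * legendre a b i

theorem legendreCoeff_mul {a b : ℝ} (hab : a < b) (u : ℝ → ℝ) (i : ℕ) :
    legendreCoeff a b u i * ((b - a) / (2 * i + 1)) =
      ∫ x in a..b, (legendre a b i).eval x * u x := by
  rw [legendreCoeff, integral_legendre_sq hab]
  have : 0 < b - a := sub_pos.2 hab
  field_simp

theorem integral_legendreSum_mul {a b : ℝ} (u : ℝ → ℝ) (s : Finset ℕ) {g : ℝ → ℝ}
    (hg : IntervalIntegrable g volume a b) :
    ∫ x in a..b, (legendreSum a b u s).eval x * g x =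
      ∑ i ∈ s, legendreCoeff a b u i * ∫ x in a..b, (legendre a b i).eval x * g x := by
  simp only [legendreSum, eval_finsetSum, Finset.sum_mul]
  rw [intervalIntegral.integral_finsetSum]
  · simp only [eval_mul, eval_C, mul_assoc, intervalIntegral.integral_const_mul]
  · exact fun i _ => hg.continuousOn_mul (Polynomial.continuous _).continuousOn

theorem integral_legendre_mul_legendreSum {a b : ℝ} (hab : a < b) (u : ℝ → ℝ) {s : Finset ℕ}
    {i : ℕ} (hi : i ∈ s) :
    ∫ x in a..b, (legendre a b i).eval x * (legendreSum a b u s).eval x =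
      ∫ x in a..b, (legendre a b i).eval x * u x := by
  have h := integral_legendreSum_mul u s (intervalIntegrable_eval (legendre a b i) a b)
  simp only [mul_comm (eval _ (legendreSum a b u s))] at h
  rw [h, Finset.sum_eq_single i]
  · rw [← legendreCoeff_mul hab u, ← integral_legendre_sq hab]
    simp only [eval_mul]
  · intro j _ hj
    have := integral_legendre_mul_legendre a b hj
    simp only [eval_mul] at this
    rw [this, mul_zero]
  · exact fun h => absurd hi h

theorem natDegree_legendreSum_le (a b : ℝ) (u : ℝ → ℝ) {s : Finset ℕ} {n : ℕ}
    (hs : ∀ i ∈ s, i ≤ n) : (legendreSum a b u s).natDegree ≤ n :=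
  natDegree_sum_le_of_forall_le _ _ fun i hi =>
    (natDegree_C_mul_le _ _).trans ((natDegree_legendre_le a b i).trans (hs i hi))

/-- The `L²(a, b)` projection of `u` onto the polynomials of degree at most `n`. -/
def polyProj (a b : ℝ) (n : ℕ) (u : ℝ → ℝ) : ℝ[X] := legendreSum a b u (Finset.range (n + 1))

theorem natDegree_polyProj_le (a b : ℝ) (n : ℕ) (u : ℝ → ℝ) : (polyProj a b n u).natDegree ≤ n :=
  natDegree_legendreSum_le a b u fun i hi => by rw [Finset.mem_range] at hi; omega

theorem integral_mul_polyProj {a b : ℝ} (hab : a < b) {n : ℕ} {u : ℝ → ℝ}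
    (hu : IntervalIntegrable u volume a b) {q : ℝ[X]} (hq : q.natDegree ≤ n) :
    ∫ x in a..b, q.eval x * (polyProj a b n u).eval x = ∫ x in a..b, q.eval x * u x := by
  obtain ⟨c, rfl⟩ := exists_eq_sum_legendre hab hq
  simp only [eval_finsetSum, Finset.sum_mul]
  rw [intervalIntegral.integral_finsetSum, intervalIntegral.integral_finsetSum]
  · refine Finset.sum_congr rfl fun i hi => ?_
    simp only [eval_mul, eval_C, mul_assoc, intervalIntegral.integral_const_mul]
    rw [polyProj, integral_legendre_mul_legendreSum hab u hi]
  · exact fun i _ => hu.continuousOn_mul (Polynomial.continuous _).continuousOn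
  · exact fun i _ => (intervalIntegrable_eval _ _ _).continuousOn_mul
      (Polynomial.continuous _).continuousOn

/-- Pythagoras: `u - polyProj` is orthogonal to polynomials of degree at most `n`. It gives best
approximation, and it also splits the error at degree `r` into the error at a higher degree and a
block of Legendre terms. -/
theorem integral_sub_sq_eq {a b : ℝ} (hab : a < b) {n : ℕ} {u : ℝ → ℝ}
    (hu : ContinuousOn u (uIcc a b)) {q : ℝ[X]} (hq : q.natDegree ≤ n) :
    ∫ x in a..b, (u x - q.eval x) ^ 2 =
      (∫ x in a..b, (u x - (polyProj a b n u).eval x) ^ 2) +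
        ∫ x in a..b, ((polyProj a b n u - q).eval x) ^ 2 := by
  have hui := hu.intervalIntegrable (μ := volume)
  set p := polyProj a b n u with hp
  have hpq : (p - q).natDegree ≤ n :=
    (natDegree_sub_le _ _).trans (max_le (natDegree_polyProj_le a b n u) hq)
  have h1 := integral_mul_polyProj hab hui hpq
  have hc : ∀ s : ℝ[X], ContinuousOn (fun x => s.eval x) (uIcc a b) :=
    fun s => (Polynomial.continuous s).continuousOn
  have h2 : ∫ x in a..b, (p - q).eval x * (u x - p.eval x) = 0 := by
    simp only [mul_sub]
    rw [intervalIntegral.integral_sub (hui.continuousOn_mul (hc _))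
      ((intervalIntegrable_eval _ _ _).continuousOn_mul (hc _)), h1, sub_self]
  have h3 : ∀ x, (u x - q.eval x) ^ 2 = (u x - p.eval x) ^ 2 + ((p - q).eval x) ^ 2 +
      2 * ((p - q).eval x * (u x - p.eval x)) := fun x => by rw [eval_sub]; ring
  simp only [h3]
  have hi1 : IntervalIntegrable (fun x => (u x - p.eval x) ^ 2) volume a b :=
    ((hu.sub (hc p)).pow 2).intervalIntegrable
  have hi2 : IntervalIntegrable (fun x => ((p - q).eval x) ^ 2) volume a b :=
    ((hc (p - q)).pow 2).intervalIntegrable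
  have hi3 : IntervalIntegrable (fun x => (p - q).eval x * (u x - p.eval x)) volume a b :=
    ((hc (p - q)).mul (hu.sub (hc p))).intervalIntegrable
  rw [intervalIntegral.integral_add (hi1.add hi2) (hi3.const_mul 2),
    intervalIntegral.integral_add hi1 hi2, intervalIntegral.integral_const_mul, h2]
  ring

/-- Completeness of the Legendre system: Weierstrass approximation together with the best
approximation property of the projection. -/
theorem exists_integral_sub_polyProj_sq_le {a b : ℝ} (hab : a < b) {u : ℝ → ℝ}
    (hu : ContinuousOn u (uIcc a b)) {ε : ℝ} (hε : 0 < ε) (m : ℕ) :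
    ∃ n, m ≤ n ∧ ∫ x in a..b, (u x - (polyProj a b n u).eval x) ^ 2 ≤ ε := by
  have hba : 0 < b - a := sub_pos.2 hab
  have hu' := hu
  rw [uIcc_of_le hab.le] at hu'
  set δ := Real.sqrt (ε / (b - a)) with hδ
  obtain ⟨q, hq⟩ := exists_polynomial_near_of_continuousOn a b u hu' δ
    (Real.sqrt_pos.2 (div_pos hε hba))
  refine ⟨max m q.natDegree, le_max_left _ _, ?_⟩
  have h1 := integral_sub_sq_eq hab hu (le_max_right m q.natDegree)
  have h2 : 0 ≤ ∫ x in a..b, ((polyProj a b (max m q.natDegree) u - q).eval x) ^ 2 :=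
    intervalIntegral.integral_nonneg hab.le fun x _ => sq_nonneg _
  have h3 : ∫ x in a..b, (u x - q.eval x) ^ 2 ≤ ∫ _ in a..b, ε / (b - a) := by
    refine intervalIntegral.integral_mono_on hab.le
      (((hu.sub (Polynomial.continuous q).continuousOn).pow 2).intervalIntegrable)
      intervalIntegrable_const fun x hx => ?_
    rw [← Real.sq_sqrt (div_pos hε hba).le, ← sq_abs, abs_sub_comm]
    exact pow_le_pow_left₀ (abs_nonneg _) (hq x hx).le 2
  rw [intervalIntegral.integral_const, smul_eq_mul, mul_div_cancel₀ _ hba.ne'] at h3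
  linarith

/-! ### Bessel-type bounds and the projection error -/

theorem iterate_derivative_legendreSum (a b : ℝ) (u : ℝ → ℝ) (s : Finset ℕ) (k : ℕ) :
    derivative^[k] (legendreSum a b u s) =
      ∑ i ∈ s, C (legendreCoeff a b u i) * derivative^[k] (legendre a b i) := by
  rw [legendreSum, iterate_derivative_sum]
  simp only [iterate_derivative_C_mul]

theorem integral_bubble_legendreSum_mul {a b : ℝ} {k : ℕ} (u : ℝ → ℝ) (s : Finset ℕ)
    {v : ℕ → ℝ → ℝ} (hv : IsDerivChain k a b v) (hk : IntervalIntegrable (v k) volume a b) :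
    ∫ x in a..b, (bubble a b ^ k * derivative^[k] (legendreSum a b u s)).eval x * v k x =
      ∑ i ∈ s, legendreCoeff a b u i *
        (legendreFactor i k * ∫ x in a..b, (legendre a b i).eval x * v 0 x) := by
  simp only [iterate_derivative_legendreSum, Finset.mul_sum, eval_finsetSum, Finset.sum_mul]
  rw [intervalIntegral.integral_finsetSum]
  · refine Finset.sum_congr rfl fun i _ => ?_
    rw [← hv.moment i, ← intervalIntegral.integral_const_mul]
    refine intervalIntegral.integral_congr fun x _ => ?_
    simp only [eval_mul, eval_C]; ring
  · exact fun i _ => hk.continuousOn_mul (Polynomial.continuous _).continuousOn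

/-- Bessel's inequality for the derivatives of Legendre polynomials. -/
theorem integral_legendreSum_sq_le {a b : ℝ} (hab : a < b) {k m : ℕ} (hkm : k ≤ m) {s : Finset ℕ}
    (hs : ∀ i ∈ s, m ≤ i) {v : ℕ → ℝ → ℝ} (hv : IsDerivChain k a b v)
    (hk : IntervalIntegrable (v k) volume a b)
    (hk2 : IntervalIntegrable (fun x => v k x ^ 2) volume a b) :
    legendreFactor m k * ∫ x in a..b, ((legendreSum a b (v 0) s).eval x) ^ 2 ≤
      ((b - a) / 2) ^ (2 * k) * ∫ x in a..b, v k x ^ 2 := by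
  have hba : 0 < b - a := sub_pos.2 hab
  set Q := legendreSum a b (v 0) s with hQ
  set G := ∫ x in a..b, v k x ^ 2 with hG
  have e1 := integral_bubble_legendreSum_mul (v 0) s hv hk
  have e2 := integral_bubble_legendreSum_mul (v 0) s (isDerivChain_polynomial k a b Q)
    (intervalIntegrable_eval _ _ _)
  rw [← hQ] at e1 e2
  -- `S` has two meanings: the pairing of `ω^k Q^{(k)}` with `v k`, and, since `Q` has the same
  -- Legendre moments over `s` as `v 0`, the weighted norm `∫ ω^k (Q^{(k)})²`. Cauchy-Schwarz
  -- therefore reads `S² ≤ H^{2k} S G` with `H = (b - a) / 2`, that is `S ≤ H^{2k} G`, and `S`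
  -- dominates `legendreFactor m k * ∫ Q²`.
  set S := ∑ i ∈ s, legendreCoeff a b (v 0) i *
        (legendreFactor i k * ∫ x in a..b, (legendre a b i).eval x * v 0 x) with hS
  have e3 : ∫ x in a..b, (bubble a b ^ k * derivative^[k] Q).eval x * (derivative^[k] Q).eval x
      = S := by
    rw [e2, hS]
    refine Finset.sum_congr rfl fun i hi => ?_
    rw [Function.iterate_zero, id, hQ, integral_legendre_mul_legendreSum hab _ hi]
  have e4 := sq_integral_bubble_mul_le hab.le k (derivative^[k] Q) hk hk2
  rw [e1, e3, ← hG] at e4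
  have e5 : legendreFactor m k * ∫ x in a..b, (Q.eval x) ^ 2 ≤ S := by
    have h1 : ∫ x in a..b, (Q.eval x) ^ 2 = ∑ i ∈ s, legendreCoeff a b (v 0) i *
        ∫ x in a..b, (legendre a b i).eval x * v 0 x := by
      have := integral_legendreSum_mul (v 0) s (intervalIntegrable_eval Q a b)
      simp only [pow_two]
      rw [← hQ] at this
      rw [this]
      refine Finset.sum_congr rfl fun i hi => ?_
      rw [hQ, integral_legendre_mul_legendreSum hab _ hi]
    rw [h1, hS, Finset.mul_sum]
    refine Finset.sum_le_sum fun i hi => ?_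
    have h2 := legendreFactor_mono hkm (hs i hi)
    rw [← legendreCoeff_mul hab]
    have h3 : 0 ≤ legendreCoeff a b (v 0) i * (legendreCoeff a b (v 0) i *
        ((b - a) / (2 * i + 1))) := by
      rw [← mul_assoc]
      exact mul_nonneg (mul_self_nonneg _) (by positivity)
    nlinarith
  have hS0 : 0 ≤ S := by
    refine le_trans (mul_nonneg (legendreFactor_pos hkm).le ?_) e5
    exact intervalIntegral.integral_nonneg hab.le fun x _ => sq_nonneg _
  have hG0 : 0 ≤ G := intervalIntegral.integral_nonneg hab.le fun x _ => sq_nonneg _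
  refine e5.trans ?_
  rcases hS0.eq_or_lt with h | h
  · rw [← h]; positivity
  · refine le_of_mul_le_mul_right ?_ h
    nlinarith

/-- The `L²` error of the `L²` projection. -/
theorem integral_sub_polyProj_sq_le {a b : ℝ} (hab : a < b) {k r : ℕ} (hkr : k ≤ r + 1)
    {v : ℕ → ℝ → ℝ} (hu : ContinuousOn (v 0) (uIcc a b)) (hv : IsDerivChain k a b v)
    (hk : IntervalIntegrable (v k) volume a b)
    (hk2 : IntervalIntegrable (fun x => v k x ^ 2) volume a b) :
    legendreFactor (r + 1) k * ∫ x in a..b, (v 0 x - (polyProj a b r (v 0)).eval x) ^ 2 ≤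
      ((b - a) / 2) ^ (2 * k) * ∫ x in a..b, v k x ^ 2 := by
  have hpos := legendreFactor_pos hkr
  -- No infinite series is needed: for some large `n` the error at degree `n` is below the
  -- tolerance, and the block of indices from `r + 1` to `n` obeys the Bessel bound uniformly in
  -- `n`.
  refine le_of_forall_pos_le_add fun ε hε => ?_
  obtain ⟨n, hrn, hn⟩ := exists_integral_sub_polyProj_sq_le hab hu (div_pos hε hpos) r
  have h1 := integral_sub_sq_eq hab hu ((natDegree_polyProj_le a b r (v 0)).trans hrn)
  have h2 : polyProj a b n (v 0) - polyProj a b r (v 0) =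
      legendreSum a b (v 0) (Finset.Ico (r + 1) (n + 1)) := by
    rw [polyProj, polyProj, legendreSum, legendreSum, legendreSum,
      Finset.sum_Ico_eq_sub _ (by omega)]
  rw [h1, h2, mul_add]
  have h3 := integral_legendreSum_sq_le hab hkr (s := Finset.Ico (r + 1) (n + 1))
    (fun i hi => (Finset.mem_Ico.1 hi).1) hv hk hk2
  rw [le_div_iff₀ hpos] at hn
  linarith

/-- The moment identity is used twice: for `v`, and for `P_n` itself, where it gives `∫ ω^k
(P_n^{(k)})² = legendreFactor n k * ∫ P_n²`. Cauchy-Schwarz then leaves one `legendreFactor` to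
divide by. -/
theorem sq_integral_legendre_mul_le {a b : ℝ} (hab : a < b) {k n : ℕ} (hkn : k ≤ n)
    {v : ℕ → ℝ → ℝ} (hv : IsDerivChain k a b v) (hk : IntervalIntegrable (v k) volume a b)
    (hk2 : IntervalIntegrable (fun x => v k x ^ 2) volume a b) :
    legendreFactor n k * (∫ x in a..b, (legendre a b n).eval x * v 0 x) ^ 2 ≤
      ((b - a) / 2) ^ (2 * k) * (b - a) * ∫ x in a..b, v k x ^ 2 := by
  have hba : 0 < b - a := sub_pos.2 hab
  have hG0 : 0 ≤ ∫ x in a..b, v k x ^ 2 :=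
    intervalIntegral.integral_nonneg hab.le fun x _ => sq_nonneg _
  have hc := legendreFactor_pos hkn
  have h1 := sq_integral_bubble_mul_le hab.le k (derivative^[k] (legendre a b n)) hk hk2
  have h2 := (isDerivChain_polynomial k a b (legendre a b n)).moment n
  have h3 := integral_legendre_sq hab n
  simp only [eval_mul (p := legendre a b n)] at h3
  rw [Function.iterate_zero, id, h3] at h2
  rw [hv.moment n, h2] at h1
  have h4 : (b - a) / (2 * n + 1) ≤ b - a := div_le_self hba.le (by
    have : (0 : ℝ) ≤ n := by positivity
    linarith)
  set J := ∫ x in a..b, (legendre a b n).eval x * v 0 x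
  set G := ∫ x in a..b, v k x ^ 2
  refine le_of_mul_le_mul_left ?_ hc
  calc legendreFactor n k * (legendreFactor n k * J ^ 2) = (legendreFactor n k * J) ^ 2 := by ring
    _ ≤ _ := h1
    _ ≤ ((b - a) / 2) ^ (2 * k) * (legendreFactor n k * (b - a)) * G := by gcongr
    _ = _ := by ring

/-- The errors of the `L²` projection at the end points are moments of the derivative. -/
theorem eval_sub_polyProj {a b : ℝ} (hab : a < b) {r : ℕ} {u u' : ℝ → ℝ}
    (hu' : IntervalIntegrable u' volume a b)
    (h : ∀ x ∈ Icc a b, u x = u a + ∫ y in a..x, u' y) (hu : ContinuousOn u (uIcc a b))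
    (α : ℝ) :
    (1 + α) * (u b - (polyProj a b r u).eval b) -
        (1 - α) * (-1) ^ r * (u a - (polyProj a b r u).eval a) =
      (∫ x in a..b, (legendre a b r).eval x * u' x) +
        α * ∫ x in a..b, (legendre a b (r + 1)).eval x * u' x := by
  set q := polyProj a b r u with hq
  -- Integrate `φ' (u - q)` by parts. The left side vanishes because `φ'` has degree at most `r`,
  -- and `φ` is orthogonal to `q'`, so the boundary terms equal `∫ φ u'`. For `α = 1` the function
  -- `φ` vanishes at `a`, for `α = -1` at `b`, which isolates the two end point errors.
  set φ : ℝ[X] := legendre a b r + C α * legendre a b (r + 1) with hφ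
  have hφb : φ.eval b = 1 + α := by simp [hφ, eval_legendre_right hab]
  have hφa : φ.eval a = (1 - α) * (-1) ^ r := by
    simp [hφ, eval_legendre_left hab, pow_succ]; ring
  have hqd : q.natDegree ≤ r := natDegree_polyProj_le a b r u
  have hdφ : (derivative φ).natDegree ≤ r := by
    refine (natDegree_derivative_le φ).trans ?_
    have : φ.natDegree ≤ r + 1 := by
      refine (natDegree_add_le _ _).trans (max_le ?_ ?_)
      · exact (natDegree_legendre_le a b r).trans r.le_succ
      · exact (natDegree_C_mul_le _ _).trans (natDegree_legendre_le a b (r + 1))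
    omega
  have e1 := integral_mul_polyProj hab hu.intervalIntegrable hdφ
  rw [← hq] at e1
  have e2 := integral_deriv_mul_of_eq_primitive hab.le hu' h (φ := fun x => φ.eval x)
    (contDiff_eval φ 1)
  simp only [Polynomial.deriv] at e2
  have e3 := integral_mul_derivative φ q a b
  have e4 : ∫ x in a..b, φ.eval x * (derivative q).eval x = 0 := by
    have hz : ∀ m, r ≤ m → ∫ x in a..b, (legendre a b m).eval x * (derivative q).eval x = 0 := by
      intro m hm
      have hdq : (derivative q).natDegree ≤ r - 1 :=
        (natDegree_derivative_le q).trans (Nat.sub_le_sub_right hqd 1)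
      rcases Nat.eq_zero_or_pos m with h0 | h0
      · have : derivative q = 0 := derivative_of_natDegree_zero (by omega)
        simp [this]
      · have := integral_mul_legendre_eq_zero hab (n := m) (q := derivative q) (by omega)
        rw [← this]
        refine intervalIntegral.integral_congr fun x _ => ?_
        simp only [eval_mul]; ring
    simp only [hφ, eval_add, eval_mul, eval_C, add_mul, mul_assoc]
    have hi : ∀ m, IntervalIntegrable (fun x => (legendre a b m).eval x * (derivative q).eval x)
        volume a b := fun m => ((Polynomial.continuous _).mul
          (Polynomial.continuous _)).intervalIntegrable _ _
    rw [intervalIntegral.integral_add (hi r) ((hi (r + 1)).const_mul α),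
      intervalIntegral.integral_const_mul, hz r le_rfl, hz (r + 1) r.le_succ]
    simp
  have e5 : ∫ x in a..b, φ.eval x * u' x = (∫ x in a..b, (legendre a b r).eval x * u' x) +
        α * ∫ x in a..b, (legendre a b (r + 1)).eval x * u' x := by
    have hi : ∀ m, IntervalIntegrable (fun x => (legendre a b m).eval x * u' x)
        volume a b := fun m => hu'.continuousOn_mul (Polynomial.continuous _).continuousOn
    simp only [hφ, eval_add, eval_mul, eval_C, add_mul, mul_assoc]
    rw [intervalIntegral.integral_add (hi r) ((hi (r + 1)).const_mul α),
      intervalIntegral.integral_const_mul]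
  rw [e4] at e3
  rw [e5] at e2
  rw [hφa, hφb] at e2 e3
  linarith

/-- The chain starts with `u` and not with `g 0`, which agrees with `u` only almost everywhere: the
projection estimates need continuity of the function at order `0`. -/
theorem isDerivChain_of_isWeakDeriv {a b : ℝ} (hab : a < b) {k : ℕ} {u : ℝ → ℝ} {g : ℕ → ℝ → ℝ}
    (hg : ∀ j ≤ k, IsWeakDeriv j a b u (g j))
    (hi : ∀ j ≤ k, IntegrableOn (g j) (Ioo a b)) :
    IsDerivChain k a b (fun j => if j = 0 then u else g j) := by
  intro j hj φ ha hb
  have h1 : IsWeakDeriv 1 a b (if j = 0 then u else g j) (g (j + 1)) := by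
    rcases Nat.eq_zero_or_pos j with rfl | h
    · exact hg 1 hj
    · rw [if_neg h.ne']
      exact (hg j hj.le).of_succ (hg (j + 1) hj)
  have h2 := h1.integral_deriv_mul hab (hi (j + 1) hj) (contDiff_eval φ 1) ha hb
  simpa using h2

/-- The error of the `L²` projection onto polynomials of degree at most `r`, in `L²` and at the
end points of the interval, in terms of the derivatives up to order `μ + 1`. -/
theorem polyProj_error_le {a b : ℝ} (hab : a < b) {r μ : ℕ} (hμ : μ ≤ r) {u : ℝ → ℝ}
    (hu : ContinuousOn u (Icc a b)) {g : ℕ → ℝ → ℝ}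
    (hg : ∀ j ≤ μ + 1, IsWeakDeriv j a b u (g j))
    (hL : ∀ j ≤ μ + 1, MemLp (g j) 2 (volume.restrict (Ioo a b))) :
    (u b - (polyProj a b r u).eval b) ^ 2 + (u a - (polyProj a b r u).eval a) ^ 2 +
        (∫ x in a..b, (u x - (polyProj a b r u).eval x) ^ 2) ≤
      5 * ((b - a) / 2) ^ (2 * μ + 1) / legendreFactor r μ *
        ∑ j ∈ Finset.range (μ + 2), ∫ x in a..b, g j x ^ 2 := by
  have hba : 0 < b - a := sub_pos.2 hab
  have hu' : ContinuousOn u (uIcc a b) := by rwa [uIcc_of_le hab.le]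
  have hi : ∀ j ≤ μ + 1, IntegrableOn (g j) (Ioo a b) := fun j hj =>
    (hL j hj).integrable (by norm_num)
  have hii : ∀ j ≤ μ + 1, IntervalIntegrable (g j) volume a b := fun j hj => by
    rw [intervalIntegrable_iff_integrableOn_Ioo_of_le hab.le]; exact hi j hj
  have hii2 : ∀ j ≤ μ + 1, IntervalIntegrable (fun x => g j x ^ 2) volume a b := fun j hj => by
    rw [intervalIntegrable_iff_integrableOn_Ioo_of_le hab.le]; exact (hL j hj).integrable_sq
  have hG : ∀ j, 0 ≤ ∫ x in a..b, g j x ^ 2 := fun j =>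
    intervalIntegral.integral_nonneg hab.le fun x _ => sq_nonneg _
  set v : ℕ → ℝ → ℝ := fun j => if j = 0 then u else g j with hv
  have hv0 : v 0 = u := rfl
  have hvi : ∀ j ≤ μ + 1, IntervalIntegrable (v j) volume a b := fun j hj => by
    rcases Nat.eq_zero_or_pos j with rfl | h
    · exact hu'.intervalIntegrable
    · rw [hv]; dsimp only; rw [if_neg h.ne']; exact hii j hj
  have hvi2 : ∀ j ≤ μ + 1, IntervalIntegrable (fun x => v j x ^ 2) volume a b := fun j hj => by
    rcases Nat.eq_zero_or_pos j with rfl | h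
    · exact (hu'.pow 2).intervalIntegrable
    · rw [hv]; simp only [h.ne', if_false]; exact hii2 j hj
  have hvG : ∀ j ≤ μ + 1, ∫ x in a..b, v j x ^ 2 = ∫ x in a..b, g j x ^ 2 := fun j hj => by
    rcases Nat.eq_zero_or_pos j with rfl | h
    · rw [intervalIntegral.integral_of_le hab.le, intervalIntegral.integral_of_le hab.le,
        integral_Ioc_eq_integral_Ioo, integral_Ioc_eq_integral_Ioo]
      refine integral_congr_ae ?_
      filter_upwards [(hg 0 hj).ae_eq_of_zero] with x hx
      rw [hx, hv0]
    · rw [hv]; simp only [h.ne', if_false]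
  have hch : IsDerivChain (μ + 1) a b v := isDerivChain_of_isWeakDeriv hab hg hi
  -- The end point errors are moments of `u'`, so the chain is shifted by one: `u'` has `μ` further
  -- derivatives.
  have hch1 : IsDerivChain μ a b (fun j => v (j + 1)) := fun j hj => hch (j + 1) (by omega)
  have hch2 : IsDerivChain μ a b v := fun j hj => hch j (by omega)
  have hc := legendreFactor_pos hμ
  set c := legendreFactor r μ with hcdef
  set H := (b - a) / 2 with hH
  have hHpos : 0 < H := by positivity
  set G := ∫ x in a..b, g (μ + 1) x ^ 2 with hGdef
  set G₀ := ∫ x in a..b, g μ x ^ 2 with hG₀def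
  have hmom : ∀ n, r ≤ n → c * (∫ x in a..b, (legendre a b n).eval x * g 1 x) ^ 2 ≤
      H ^ (2 * μ) * (b - a) * G := by
    intro n hn
    have h1 := sq_integral_legendre_mul_le hab (hμ.trans hn) hch1 (hvi (μ + 1) le_rfl)
      (hvi2 (μ + 1) le_rfl)
    rw [hvG (μ + 1) le_rfl] at h1
    refine le_trans ?_ h1
    exact mul_le_mul_of_nonneg_right (legendreFactor_mono hμ hn) (sq_nonneg _)
  have h0 := hmom r le_rfl
  have h1 := hmom (r + 1) r.le_succ
  have hprim := (hg 1 (by omega)).eq_primitive hab (hi 1 (by omega)) hu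
  have hb1 := eval_sub_polyProj hab (r := r) (hii 1 (by omega)) hprim hu' 1
  have ha1 := eval_sub_polyProj hab (r := r) (hii 1 (by omega)) hprim hu' (-1)
  set J₀ := ∫ x in a..b, (legendre a b r).eval x * g 1 x
  set J₁ := ∫ x in a..b, (legendre a b (r + 1)).eval x * g 1 x
  set eb := u b - (polyProj a b r u).eval b
  set ea := u a - (polyProj a b r u).eval a
  have hsq : ((-1 : ℝ) ^ r) ^ 2 = 1 := by rw [← pow_mul, mul_comm, pow_mul]; norm_num
  -- Here `eb = (J₀ + J₁) / 2` and `ea = ±(J₀ - J₁) / 2`, so the cross terms cancel in the sum of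
  -- squares. With the `L²` part below, the constants `4` and `1` add up to the `5` of the
  -- statement.
  have hend : c * (eb ^ 2 + ea ^ 2) ≤ 4 * (H ^ (2 * μ + 1) * G) := by
    have e1 : 4 * eb ^ 2 = (J₀ + J₁) ^ 2 := by rw [show J₀ + J₁ = 2 * eb by linarith]; ring
    have e2 : 4 * ea ^ 2 = (J₀ - J₁) ^ 2 := by
      rw [show J₀ - J₁ = -2 * ((-1) ^ r * ea) by linarith, mul_pow, mul_pow, hsq]; ring
    have e3 : b - a = 2 * H := by rw [hH]; ring
    rw [e3] at h0 h1
    have e4 : eb ^ 2 + ea ^ 2 = (J₀ ^ 2 + J₁ ^ 2) / 2 := by linear_combination (e1 + e2) / 4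
    rw [e4, pow_succ H]
    have : 0 ≤ H ^ (2 * μ) * H * G := by have := hG (μ + 1); positivity
    linarith
  have hL1 : c * (∫ x in a..b, (u x - (polyProj a b r u).eval x) ^ 2) ≤
      H ^ (2 * μ + 1) * (G + G₀) := by
    set E := ∫ x in a..b, (u x - (polyProj a b r u).eval x) ^ 2 with hE
    have hE0 : 0 ≤ E := intervalIntegral.integral_nonneg hab.le fun x _ => sq_nonneg _
    -- On a short slab all `μ + 1` derivatives are used and one power of `H` is given away; on a
    -- long slab only `μ` are used and one power is added. Both cases give the exponent `2 μ + 1`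
    -- with a constant independent of the slab length.
    rcases le_total H 1 with hH1 | hH1
    · have h2 := integral_sub_polyProj_sq_le hab (r := r) (k := μ + 1) (by omega)
        (v := v) hu' hch (hvi _ le_rfl) (hvi2 _ le_rfl)
      rw [hvG _ le_rfl, hv0, ← hE] at h2
      have h3 := mul_le_mul_of_nonneg_right (legendreFactor_succ_ge hμ) hE0
      have h4 : H ^ (2 * (μ + 1)) ≤ H ^ (2 * μ + 1) :=
        pow_le_pow_of_le_one hHpos.le hH1 (by omega)
      calc c * E ≤ _ := h3
        _ ≤ _ := h2
        _ ≤ H ^ (2 * μ + 1) * G := mul_le_mul_of_nonneg_right h4 (hG _)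
        _ ≤ _ := by gcongr; linarith [hG μ]
    · have h2 := integral_sub_polyProj_sq_le hab (r := r) (k := μ) (by omega)
        (v := v) hu' hch2 (hvi _ (by omega)) (hvi2 _ (by omega))
      rw [hvG _ (by omega), hv0, ← hE] at h2
      have h3 := mul_le_mul_of_nonneg_right (legendreFactor_mono hμ r.le_succ) hE0
      have h4 : H ^ (2 * μ) ≤ H ^ (2 * μ + 1) := pow_le_pow_right₀ hH1 (by omega)
      calc c * E ≤ _ := h3
        _ ≤ _ := h2
        _ ≤ H ^ (2 * μ + 1) * G₀ := mul_le_mul_of_nonneg_right h4 (hG _)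
        _ ≤ _ := by gcongr; linarith [hG (μ + 1)]
  have hsum : G + G₀ ≤ ∑ j ∈ Finset.range (μ + 2), ∫ x in a..b, g j x ^ 2 := by
    rw [Finset.sum_range_succ, Finset.sum_range_succ]
    have := Finset.sum_nonneg fun j (_ : j ∈ Finset.range μ) => hG j
    linarith
  rw [div_mul_eq_mul_div, le_div_iff₀ hc]
  have hGG : G ≤ G + G₀ := by linarith [hG μ]
  have hHp : 0 ≤ H ^ (2 * μ + 1) := by positivity
  calc _ = c * (eb ^ 2 + ea ^ 2) +
        c * (∫ x in a..b, (u x - (polyProj a b r u).eval x) ^ 2) := by ring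
    _ ≤ 4 * (H ^ (2 * μ + 1) * G) + H ^ (2 * μ + 1) * (G + G₀) := add_le_add hend hL1
    _ ≤ 5 * H ^ (2 * μ + 1) * (G + G₀) := by nlinarith
    _ ≤ _ := by gcongr

end Projection

end TimeDG

end

noncomputable section

namespace TimeDG

/-! ### Bilinear forms of block matrices -/

section Forms

variable {d : ℕ}

/-- The bilinear form `(B x) · y`. -/
def bform (B : BlockMat d) (x y : State d) : ℝ := inner ℝ (act B x) y

theorem act_eq_toEuclideanCLM (B : BlockMat d) (x : State d) :
    act B x = Matrix.toEuclideanCLM (𝕜 := ℝ) B x := rfl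

theorem continuous_act (B : BlockMat d) : Continuous (act B) :=
  (Matrix.toEuclideanCLM (𝕜 := ℝ) B).continuous

theorem act_add (B : BlockMat d) (x y : State d) : act B (x + y) = act B x + act B y := by
  simp only [act_eq_toEuclideanCLM, map_add]

theorem act_sub (B : BlockMat d) (x y : State d) : act B (x - y) = act B x - act B y := by
  simp only [act_eq_toEuclideanCLM, map_sub]

theorem act_smul (B : BlockMat d) (c : ℝ) (x : State d) : act B (c • x) = c • act B x := by
  simp only [act_eq_toEuclideanCLM, map_smul]

theorem bform_add_left (B : BlockMat d) (x y w : State d) :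
    bform B (x + y) w = bform B x w + bform B y w := by
  simp only [bform, act_add, inner_add_left]

theorem bform_sub_left (B : BlockMat d) (x y w : State d) :
    bform B (x - y) w = bform B x w - bform B y w := by
  simp only [bform, act_sub, inner_sub_left]

theorem bform_add_right (B : BlockMat d) (x y w : State d) :
    bform B w (x + y) = bform B w x + bform B w y := by
  simp only [bform, inner_add_right]

theorem bform_sub_right (B : BlockMat d) (x y w : State d) :
    bform B w (x - y) = bform B w x - bform B w y := by
  simp only [bform, inner_sub_right]

theorem bform_smul_left (B : BlockMat d) (c : ℝ) (x y : State d) :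
    bform B (c • x) y = c * bform B x y := by
  simp only [bform, act_smul, real_inner_smul_left]

theorem bform_smul_right (B : BlockMat d) (c : ℝ) (x y : State d) :
    bform B x (c • y) = c * bform B x y := by
  simp only [bform, real_inner_smul_right]

theorem bform_eq_sum (B : BlockMat d) (x y : State d) :
    bform B x y = ∑ i, ∑ j, B i j * (x j * y i) := by
  simp only [bform, act, PiLp.inner_apply, Matrix.mulVec, dotProduct]
  refine Finset.sum_congr rfl fun i _ => ?_
  simp only [RCLike.inner_apply, conj_trivial, Finset.mul_sum]
  refine Finset.sum_congr rfl fun j _ => ?_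
  ring

theorem bform_symm {B : BlockMat d} (hB : B.IsHermitian) (x y : State d) :
    bform B x y = bform B y x := by
  rw [bform_eq_sum, bform_eq_sum, Finset.sum_comm]
  refine Finset.sum_congr rfl fun i _ => Finset.sum_congr rfl fun j _ => ?_
  have := hB.apply j i
  simp only [star_trivial] at this
  rw [this]; ring

theorem sum_quadratic_nonneg {n : Type*} [Fintype n] {B : Matrix n n ℝ} (hB : B.PosSemidef)
    (x : n → ℝ) : 0 ≤ ∑ i, ∑ j, B i j * (x j * x i) := by
  have := hB.dotProduct_mulVec_nonneg x
  simpa [dotProduct, Matrix.mulVec, Finset.mul_sum, mul_comm, mul_left_comm, mul_assoc] using this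

theorem bform_self_nonneg {B : BlockMat d} (hB : B.PosSemidef) (x : State d) : 0 ≤ bform B x x := by
  rw [bform_eq_sum]
  exact sum_quadratic_nonneg hB x.ofLp

/-- Young's inequality for a positive semidefinite form. -/
theorem bform_le {B : BlockMat d} (hB : B.PosSemidef) (x y : State d) :
    bform B x y ≤ bform B x x + 1 / 4 * bform B y y := by
  -- The weight `1 / 2` leaves `1 / 4` on the second argument, half of the coefficient `1 / 2` that
  -- jumps and final trace carry in the energy norm.
  have h := bform_self_nonneg hB (x - (1 / 2 : ℝ) • y)
  rw [bform_sub_left, bform_sub_right, bform_sub_right, bform_smul_left, bform_smul_right,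
    bform_smul_left, bform_smul_right, bform_symm hB.1 y x] at h
  linarith

theorem bform_add_self_le {B : BlockMat d} (hB : B.PosSemidef) (x y : State d) :
    bform B (x + y) (x + y) ≤ 2 * bform B x x + 2 * bform B y y := by
  have h := bform_self_nonneg hB (x - y)
  rw [bform_sub_left, bform_sub_right, bform_sub_right, bform_symm hB.1 y x] at h
  rw [bform_add_left, bform_add_right, bform_add_right, bform_symm hB.1 y x]
  linarith

theorem bform_sub_self_le {B : BlockMat d} (hB : B.PosSemidef) (x y : State d) :
    bform B (x - y) (x - y) ≤ 2 * bform B x x + 2 * bform B y y := by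
  have h := bform_self_nonneg hB (x + y)
  rw [bform_add_left, bform_add_right, bform_add_right, bform_symm hB.1 y x] at h
  rw [bform_sub_left, bform_sub_right, bform_sub_right, bform_symm hB.1 y x]
  linarith

section Msqrt

open scoped MatrixOrder

theorem msqrt_mul_self {n : Type*} [Fintype n] [DecidableEq n] {B : Matrix n n ℝ}
    (hB : B.PosSemidef) : msqrt B * msqrt B = B :=
  CFC.sqrt_mul_sqrt_self B (Matrix.nonneg_iff_posSemidef.2 hB)

theorem msqrt_isHermitian {n : Type*} [Fintype n] [DecidableEq n] (B : Matrix n n ℝ) :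
    (msqrt B).IsHermitian :=
  (Matrix.nonneg_iff_posSemidef.1 (CFC.sqrt_nonneg B)).1

end Msqrt

theorem bform_mul_self {B : BlockMat d} (hB : B.IsHermitian) (x : State d) :
    bform (B * B) x x = ‖act B x‖ ^ 2 := by
  have h : act (B * B) x = act B (act B x) := by
    simp only [act_eq_toEuclideanCLM, map_mul, mul_apply_eq_comp]
  rw [bform, h, ← bform, bform_symm hB, bform, real_inner_self_eq_norm_sq]

theorem norm_act_msqrt_sq {B : BlockMat d} (hB : B.PosSemidef) (x : State d) :
    ‖act (msqrt B) x‖ ^ 2 = bform B x x := by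
  rw [← bform_mul_self (msqrt_isHermitian B), msqrt_mul_self hB]

theorem bform_fromBlocks_diag (A D : Matrix (Fin d) (Fin d) ℝ) (x y : State d) :
    bform (Matrix.fromBlocks A 0 0 D) x y =
      (∑ i, ∑ j, A i j * (x (Sum.inl j) * y (Sum.inl i))) +
        ∑ i, ∑ j, D i j * (x (Sum.inr j) * y (Sum.inr i)) := by
  rw [bform_eq_sum]
  simp [Fintype.sum_sum_type]

theorem posSemidef_fromBlocks {A D : Matrix (Fin d) (Fin d) ℝ} (hA : A.PosSemidef)
    (hD : D.PosSemidef) : (Matrix.fromBlocks A 0 0 D).PosSemidef := by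
  refine Matrix.PosSemidef.of_dotProduct_mulVec_nonneg
    (hA.1.fromBlocks (by simp) hD.1) fun x => ?_
  have h := bform_fromBlocks_diag A D (WithLp.toLp 2 x) (WithLp.toLp 2 x)
  have h1 := sum_quadratic_nonneg hA fun i => x (Sum.inl i)
  have h2 := sum_quadratic_nonneg hD fun i => x (Sum.inr i)
  have h3 : bform (Matrix.fromBlocks A 0 0 D) (WithLp.toLp 2 x) (WithLp.toLp 2 x) =
      star x ⬝ᵥ (Matrix.fromBlocks A 0 0 D).mulVec x := by
    rw [bform, act, EuclideanSpace.inner_eq_star_dotProduct]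
    simp
  rw [← h3, h]
  exact add_nonneg h1 h2

/-! ### Bounds by maximal absolute row sums -/

theorem sum_abs_le_infNorm (B : Matrix (Fin d) (Fin d) ℝ) (i : Fin d) :
    ∑ j, |B i j| ≤ infNorm B :=
  le_ciSup (f := fun i => ∑ j, |B i j|) (Set.finite_range _).bddAbove i

theorem infNorm_nonneg (B : Matrix (Fin d) (Fin d) ℝ) : 0 ≤ infNorm B :=
  Real.iSup_nonneg fun _ => Finset.sum_nonneg fun _ _ => abs_nonneg _

/-- Schur's test: split `|x_i x_j|` into half squares; by symmetry both halves sum to the same row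
sums. This is why no dimension enters the constant. -/
theorem sum_quadratic_le {B : Matrix (Fin d) (Fin d) ℝ} (hB : B.IsHermitian) {M : ℝ}
    (hM : infNorm B ≤ M) (x : Fin d → ℝ) :
    ∑ i, ∑ j, B i j * (x j * x i) ≤ M * ∑ i, x i ^ 2 := by
  have hs : ∀ i j, B i j = B j i := fun i j => by simpa using hB.apply j i
  have h1 : ∑ i, ∑ j, B i j * (x j * x i) ≤
      ∑ i, ∑ j, (|B i j| * x i ^ 2 / 2 + |B i j| * x j ^ 2 / 2) := by
    refine Finset.sum_le_sum fun i _ => Finset.sum_le_sum fun j _ => ?_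
    have h2 : B i j * (x j * x i) ≤ |B i j| * |x j * x i| := by
      rw [← abs_mul]; exact le_abs_self _
    have h3 : |x j * x i| ≤ (x i ^ 2 + x j ^ 2) / 2 := by
      rw [abs_le]; constructor <;> nlinarith [sq_nonneg (x i - x j), sq_nonneg (x i + x j)]
    nlinarith [mul_le_mul_of_nonneg_left h3 (abs_nonneg (B i j))]
  have h2 : ∑ i, ∑ j, |B i j| * x j ^ 2 / 2 = ∑ i, ∑ j, |B i j| * x i ^ 2 / 2 := by
    rw [Finset.sum_comm]
    refine Finset.sum_congr rfl fun i _ => Finset.sum_congr rfl fun j _ => ?_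
    rw [hs]
  simp only [Finset.sum_add_distrib] at h1
  rw [h2, ← Finset.sum_add_distrib] at h1
  refine h1.trans ?_
  rw [Finset.mul_sum]
  refine Finset.sum_le_sum fun i _ => ?_
  rw [← Finset.sum_add_distrib]
  have h3 : ∑ j, (|B i j| * x i ^ 2 / 2 + |B i j| * x i ^ 2 / 2) = (∑ j, |B i j|) * x i ^ 2 := by
    rw [Finset.sum_mul]; exact Finset.sum_congr rfl fun j _ => by ring
  rw [h3]
  exact mul_le_mul_of_nonneg_right ((sum_abs_le_infNorm B i).trans hM) (sq_nonneg _)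

theorem norm_sq_eq_sum_inl_inr (x : State d) :
    ‖x‖ ^ 2 = (∑ i, x (Sum.inl i) ^ 2) + ∑ i, x (Sum.inr i) ^ 2 := by
  rw [EuclideanSpace.real_norm_sq_eq, Fintype.sum_sum_type]

theorem bform_Ktilde_le {P K : Matrix (Fin d) (Fin d) ℝ} (hP : P.PosDef) (hK : K.PosDef) {M : ℝ}
    (hPM : infNorm P ≤ M) (hKM : infNorm K ≤ M) (x : State d) :
    bform (Ktilde P K) x x ≤ M * ‖x‖ ^ 2 := by
  rw [Ktilde, bform_fromBlocks_diag, norm_sq_eq_sum_inl_inr, mul_add]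
  exact add_le_add (sum_quadratic_le hK.posSemidef.1 hKM fun i => x (Sum.inl i))
    (sum_quadratic_le hP.posSemidef.1 hPM fun i => x (Sum.inr i))

theorem norm_act_Ltilde_sq {L : Matrix (Fin d) (Fin d) ℝ} (hL : L.PosSemidef) (x : State d) :
    ‖act (Ltilde L) x‖ ^ 2 = ∑ i, ∑ j, L i j * (x (Sum.inr j) * x (Sum.inr i)) := by
  have h1 : (Ltilde L).IsHermitian :=
    Matrix.isHermitian_zero.fromBlocks (by simp) (msqrt_isHermitian L)
  have h2 : Ltilde L * Ltilde L = Matrix.fromBlocks 0 0 0 L := by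
    rw [Ltilde, Matrix.fromBlocks_multiply]
    simp [msqrt_mul_self hL]
  rw [← bform_mul_self h1, h2, bform_fromBlocks_diag]
  simp

theorem norm_act_Ltilde_sq_le {L : Matrix (Fin d) (Fin d) ℝ} (hL : L.PosDef) {M : ℝ}
    (hM : infNorm L ≤ M) (x : State d) : ‖act (Ltilde L) x‖ ^ 2 ≤ M * ‖x‖ ^ 2 := by
  rw [norm_act_Ltilde_sq hL.posSemidef]
  refine (sum_quadratic_le hL.posSemidef.1 hM fun i => x (Sum.inr i)).trans ?_
  have hM0 : 0 ≤ M := (infNorm_nonneg L).trans hM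
  rw [norm_sq_eq_sum_inl_inr]
  refine mul_le_mul_of_nonneg_left (le_add_of_nonneg_left ?_) hM0
  exact Finset.sum_nonneg fun _ _ => sq_nonneg _

/-- The blocks `-K` and `K` contribute opposite terms since `K` is symmetric; only `L` dissipates.
-/
theorem bform_Amat_self {L K : Matrix (Fin d) (Fin d) ℝ} (hL : L.PosSemidef) (hK : K.IsHermitian)
    (x : State d) : bform (Amat L K) x x = ‖act (Ltilde L) x‖ ^ 2 := by
  have hs : ∀ i j, K i j = K j i := fun i j => by simpa using hK.apply j i
  rw [norm_act_Ltilde_sq hL, bform_eq_sum, Amat]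
  simp only [Fintype.sum_sum_type, Matrix.fromBlocks_apply₁₁, Matrix.fromBlocks_apply₁₂,
    Matrix.fromBlocks_apply₂₁, Matrix.fromBlocks_apply₂₂, Matrix.zero_apply, Matrix.neg_apply,
    zero_mul, Finset.sum_const_zero, zero_add, Finset.sum_add_distrib]
  have : ∑ i, ∑ j, K i j * (x (Sum.inl j) * x (Sum.inr i)) =
      ∑ i, ∑ j, K i j * (x (Sum.inr j) * x (Sum.inl i)) := by
    rw [Finset.sum_comm]
    refine Finset.sum_congr rfl fun i _ => Finset.sum_congr rfl fun j _ => ?_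
    rw [hs]; ring
  rw [this]
  simp only [neg_mul, Finset.sum_neg_distrib]
  ring

end Forms

/-! ### Vectors of polynomials -/

section EvalVec

open Polynomial

variable {d : ℕ}

/-- The vector-valued polynomial with components `p`. -/
def evalVec (p : Fin d ⊕ Fin d → ℝ[X]) (τ : ℝ) : State d := WithLp.toLp 2 fun i => (p i).eval τ

theorem evalVec_apply (p : Fin d ⊕ Fin d → ℝ[X]) (τ : ℝ) (i : Fin d ⊕ Fin d) :
    evalVec p τ i = (p i).eval τ := rfl

theorem evalVec_sub (p q : Fin d ⊕ Fin d → ℝ[X]) (τ : ℝ) :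
    evalVec (fun i => p i - q i) τ = evalVec p τ - evalVec q τ := by
  ext i; simp [evalVec]

theorem continuous_evalVec (p : Fin d ⊕ Fin d → ℝ[X]) : Continuous (evalVec p) :=
  (PiLp.continuous_toLp 2 _).comp (continuous_pi fun i => (p i).continuous)

theorem hasDerivAt_evalVec (p : Fin d ⊕ Fin d → ℝ[X]) (τ : ℝ) :
    HasDerivAt (evalVec p) (evalVec (fun i => derivative (p i)) τ) τ := by
  have h : HasDerivAt (fun τ => fun i => (p i).eval τ) (fun i => (derivative (p i)).eval τ) τ :=
    hasDerivAt_pi.2 fun i => (p i).hasDerivAt τ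
  exact (PiLp.hasFDerivAt_toLp (𝕜 := ℝ) 2 (fun i => (p i).eval τ)).comp_hasDerivAt τ h

/-- Agreement on the open slab suffices, as the trace ignores the value at the node. The energy norm
and the forms can thus be computed from one continuous function per slab. -/
theorem rightLim_eq_of_eqOn {a b : ℝ} (hab : a < b) {v F : ℝ → State d}
    (hF : ContinuousOn F (Icc a b)) (h : EqOn v F (Ioo a b)) : Function.rightLim v a = F a := by
  refine rightLim_eq_of_tendsto ?_
  have h1 : Tendsto F (𝓝[Ioo a b] a) (𝓝 (F a)) :=
    (hF a (left_mem_Icc.2 hab.le)).mono Ioo_subset_Icc_self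
  rw [nhdsWithin_Ioo_eq_nhdsGT hab] at h1
  refine h1.congr' ?_
  filter_upwards [Ioo_mem_nhdsGT hab] with x hx using (h hx).symm

theorem leftLim_eq_of_eqOn {a b : ℝ} (hab : a < b) {v F : ℝ → State d}
    (hF : ContinuousOn F (Icc a b)) (h : EqOn v F (Ioo a b)) : Function.leftLim v b = F b := by
  refine leftLim_eq_of_tendsto ?_
  have h1 : Tendsto F (𝓝[Ioo a b] b) (𝓝 (F b)) :=
    (hF b (right_mem_Icc.2 hab.le)).mono Ioo_subset_Icc_self
  rw [nhdsWithin_Ioo_eq_nhdsLT hab] at h1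
  refine h1.congr' ?_
  filter_upwards [Ioo_mem_nhdsLT hab] with x hx using (h hx).symm

theorem deriv_eq_of_eqOn {a b : ℝ} {v : ℝ → State d} {p : Fin d ⊕ Fin d → ℝ[X]}
    (h : EqOn v (evalVec p) (Ioo a b)) {τ : ℝ} (hτ : τ ∈ Ioo a b) :
    deriv v τ = evalVec (fun i => derivative (p i)) τ := by
  rw [← (hasDerivAt_evalVec p τ).deriv]
  exact (h.eventuallyEq_of_mem (isOpen_Ioo.mem_nhds hτ)).deriv_eq

theorem integral_bform {a b : ℝ} (B : BlockMat d) {x y : ℝ → State d}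
    (h : ∀ i j, IntervalIntegrable (fun τ => x τ j * y τ i) volume a b) :
    ∫ τ in a..b, bform B (x τ) (y τ) = ∑ i, ∑ j, B i j * ∫ τ in a..b, x τ j * y τ i := by
  simp only [bform_eq_sum]
  rw [intervalIntegral.integral_finsetSum]
  · refine Finset.sum_congr rfl fun i _ => ?_
    rw [intervalIntegral.integral_finsetSum]
    · simp only [intervalIntegral.integral_const_mul]
    · exact fun j _ => (h i j).const_mul _
  · intro i _
    have := IntervalIntegrable.sum Finset.univ (fun j _ => (h i j).const_mul (B i j))
    rwa [Finset.sum_fn] at this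

theorem continuous_bform_evalVec (B : BlockMat d) (p q : Fin d ⊕ Fin d → ℝ[X]) :
    Continuous fun τ => bform B (evalVec p τ) (evalVec q τ) :=
  ((continuous_act B).comp (continuous_evalVec p)).inner (continuous_evalVec q)

/-- The componentwise `L²(a, b)` projection. -/
def vecProj (a b : ℝ) (n : ℕ) (z : ℝ → State d) : Fin d ⊕ Fin d → ℝ[X] :=
  fun i => polyProj a b n fun τ => z τ i

theorem integral_bform_self_derivative {B : BlockMat d} (hB : B.IsHermitian)
    (p : Fin d ⊕ Fin d → ℝ[X]) (a b : ℝ) :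
    ∫ τ in a..b, bform B (evalVec (fun i => derivative (p i)) τ) (evalVec p τ) =
      1 / 2 * (bform B (evalVec p b) (evalVec p b) - bform B (evalVec p a) (evalVec p a)) := by
  have h : ∀ τ, HasDerivAt (fun τ => 1 / 2 * bform B (evalVec p τ) (evalVec p τ))
      (bform B (evalVec (fun i => derivative (p i)) τ) (evalVec p τ)) τ := by
    intro τ
    have h1 := (Matrix.toEuclideanCLM (𝕜 := ℝ) B).hasFDerivAt.comp_hasDerivAt τ
      (hasDerivAt_evalVec p τ)
    have h2 := (h1.inner ℝ (hasDerivAt_evalVec p τ)).const_mul (1 / 2)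
    refine h2.congr_deriv ?_
    have h3 := bform_symm hB (evalVec p τ) (evalVec (fun i => derivative (p i)) τ)
    simp only [bform, act_eq_toEuclideanCLM] at h3 ⊢
    rw [Function.comp_apply, h3]
    ring
  rw [intervalIntegral.integral_eq_sub_of_hasDerivAt (fun τ _ => h τ)
    ((continuous_bform_evalVec B _ p).intervalIntegrable _ _)]
  ring

/-- On one slab, the projection error only enters through the traces. -/
theorem integral_bform_deriv_eq {a b : ℝ} (hab : a < b) (B : BlockMat d) {n : ℕ}
    {z z' : ℝ → State d} (hz : ContinuousOn z (Icc a b))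
    (hz' : ∀ i, IntervalIntegrable (fun τ => z' τ i) volume a b)
    (h : ∀ i, ∀ x ∈ Icc a b, z x i = z a i + ∫ τ in a..x, z' τ i)
    {q : Fin d ⊕ Fin d → ℝ[X]} (hq : ∀ i, (q i).natDegree ≤ n) :
    ∫ τ in a..b, bform B (z' τ) (evalVec q τ) =
      (∫ τ in a..b, bform B (evalVec (fun i => derivative (vecProj a b n z i)) τ) (evalVec q τ)) +
        (bform B (z b - evalVec (vecProj a b n z) b) (evalVec q b) -
          bform B (z a - evalVec (vecProj a b n z) a) (evalVec q a)) := by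
  have hzi : ∀ i, ContinuousOn (fun τ => z τ i) (uIcc a b) := fun i => by
    rw [uIcc_of_le hab.le]
    exact (EuclideanSpace.proj i : State d →L[ℝ] ℝ).continuous.comp_continuousOn hz
  rw [integral_bform B (fun i j => (hz' j).mul_continuousOn (Polynomial.continuous _).continuousOn),
    integral_bform B (fun i j => ((Polynomial.continuous _).mul
      (Polynomial.continuous _)).intervalIntegrable _ _), bform_eq_sum, bform_eq_sum,
    ← Finset.sum_sub_distrib, ← Finset.sum_add_distrib]
  refine Finset.sum_congr rfl fun i _ => ?_
  rw [← Finset.sum_sub_distrib, ← Finset.sum_add_distrib]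
  refine Finset.sum_congr rfl fun j _ => ?_
  have e1 := integral_deriv_mul_of_eq_primitive hab.le (hz' j) (h j) (contDiff_eval (q i) 1)
  simp only [Polynomial.deriv] at e1
  have e2 := integral_mul_derivative (q i) (vecProj a b n z j) a b
  -- The derivative of `q i` has degree at most `n`, so it cannot distinguish `z` from its
  -- projection; after both integrations by parts only boundary terms differ.
  have e3 := integral_mul_polyProj hab (hzi j).intervalIntegrable (n := n)
    (q := derivative (q i)) ((natDegree_derivative_le _).trans ((Nat.sub_le _ _).trans (hq i)))
  have e4 : ∫ τ in a..b, z' τ j * (q i).eval τ = ∫ τ in a..b, (q i).eval τ * z' τ j := by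
    simp only [mul_comm]
  have e5 : ∫ τ in a..b, (derivative (vecProj a b n z j)).eval τ * (q i).eval τ =
      ∫ τ in a..b, (q i).eval τ * (derivative (vecProj a b n z j)).eval τ := by
    simp only [mul_comm]
  change _ = ∫ τ in a..b, (derivative (q i)).eval τ * z τ j at e3
  simp only [evalVec_apply, PiLp.sub_apply, e4, e5]
  change ∫ τ in a..b, (derivative (q i)).eval τ * (vecProj a b n z j).eval τ = _ at e3
  rw [e3, e1] at e2
  linear_combination (-B i j) * e2

theorem integral_bform_vecProj {a b : ℝ} (hab : a < b) (B : BlockMat d) {n : ℕ}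
    {z : ℝ → State d} (hz : ContinuousOn z (Icc a b))
    {q : Fin d ⊕ Fin d → ℝ[X]} (hq : ∀ i, (q i).natDegree ≤ n) :
    ∫ τ in a..b, bform B (z τ) (evalVec q τ) =
      ∫ τ in a..b, bform B (evalVec (vecProj a b n z) τ) (evalVec q τ) := by
  have hzi : ∀ i, ContinuousOn (fun τ => z τ i) (uIcc a b) := fun i => by
    rw [uIcc_of_le hab.le]
    exact (EuclideanSpace.proj i : State d →L[ℝ] ℝ).continuous.comp_continuousOn hz
  rw [integral_bform B (fun i j => ((hzi j).mul
      (Polynomial.continuous _).continuousOn).intervalIntegrable),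
    integral_bform B (fun i j => ((Polynomial.continuous _).mul
      (Polynomial.continuous _)).intervalIntegrable _ _)]
  refine Finset.sum_congr rfl fun i _ => Finset.sum_congr rfl fun j _ => ?_
  have e3 := integral_mul_polyProj hab (hzi j).intervalIntegrable (hq i)
  simp only [evalVec_apply, vecProj, mul_comm _ (eval _ (q i))]
  rw [e3]

end EvalVec

end TimeDG

end

noncomputable section

namespace TimeDG

/-! ### Energy identities for the discontinuous Galerkin method -/

section Energy

open Polynomial

variable {d : ℕ}

/-- The indices `L` and `R` denote traces at the left and right end of slab `n`, and `η + θ` is the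
full error, so the left side collects the boundary terms of the integration by parts and the jump
and initial terms of the scheme. Every `ηL n` occurs twice with opposite signs and drops out; only
the right end traces of `η` survive, paired with jumps of `θ` and with its final value. -/
theorem trace_identity {B : BlockMat d} (hB : B.IsHermitian) (ηL ηR θL θR : ℕ → State d) (m : ℕ) :
    -(∑ n ∈ Finset.range (m + 1), (bform B (ηR n) (θR n) - bform B (ηL n) (θL n))) +
        (∑ n ∈ Finset.Ico 1 (m + 1),
          bform B (ηR (n - 1) + θR (n - 1) - (ηL n + θL n)) (θL n)) -
        bform B (ηL 0 + θL 0) (θL 0) =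
      (∑ n ∈ Finset.range (m + 1),
          1 / 2 * (bform B (θR n) (θR n) - bform B (θL n) (θL n))) -
        1 / 2 * bform B (θL 0) (θL 0) -
        1 / 2 * (∑ n ∈ Finset.Ico 1 (m + 1),
          bform B (θL n - θR (n - 1)) (θL n - θR (n - 1))) -
        1 / 2 * bform B (θR m) (θR m) +
        (∑ n ∈ Finset.Ico 1 (m + 1), bform B (ηR (n - 1)) (θL n - θR (n - 1))) -
        bform B (ηR m) (θR m) := by
  induction m with
  | zero =>
    simp only [zero_add, Finset.sum_range_one, Finset.Ico_self, Finset.sum_empty, bform_add_left]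
    ring
  | succ m ih =>
    rw [Finset.sum_range_succ, Finset.sum_range_succ _ (m + 1),
      Finset.sum_Ico_succ_top (show 1 ≤ m + 1 by omega),
      Finset.sum_Ico_succ_top (show 1 ≤ m + 1 by omega),
      Finset.sum_Ico_succ_top (show 1 ≤ m + 1 by omega), Nat.add_sub_cancel]
    have h1 := bform_symm hB (θR m) (θL (m + 1))
    simp only [bform_sub_left _ (θL (m + 1)), bform_sub_right _ (θL (m + 1)),
      bform_sub_left _ (ηR m + θR m), bform_add_left _ (ηR m), bform_add_left _ (ηL (m + 1)), h1]
    linear_combination ih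

/-- The squared energy norm of a function given by `F n` on the `n`-th slab. -/
def brokenEnergy (P L K : Matrix (Fin d) (Fin d) ℝ) (m : ℕ) (t : ℕ → ℝ) (F : ℕ → ℝ → State d) :
    ℝ :=
  (∑ n ∈ Finset.range (m + 1), ∫ τ in t n..t (n + 1), ‖act (Ltilde L) (F n τ)‖ ^ 2) +
    1 / 2 * bform (Ktilde P K) (F 0 (t 0)) (F 0 (t 0)) +
    1 / 2 * (∑ n ∈ Finset.Ico 1 (m + 1),
      bform (Ktilde P K) (F n (t n) - F (n - 1) (t n)) (F n (t n) - F (n - 1) (t n))) +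
    1 / 2 * bform (Ktilde P K) (F m (t (m + 1))) (F m (t (m + 1)))

theorem Ktilde_posSemidef {P K : Matrix (Fin d) (Fin d) ℝ} (hP : P.PosDef) (hK : K.PosDef) :
    (Ktilde P K).PosSemidef :=
  posSemidef_fromBlocks hK.posSemidef hP.posSemidef

theorem jump_eq {m : ℕ} {t : ℕ → ℝ} (ht : ∀ n < m + 1, t n < t (n + 1)) {F : ℕ → ℝ → State d}
    (hF : ∀ n < m + 1, ContinuousOn (F n) (Icc (t n) (t (n + 1)))) {e : ℝ → State d}
    (he : ∀ n < m + 1, EqOn e (F n) (Ioo (t n) (t (n + 1)))) {n : ℕ}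
    (hn : n ∈ Finset.Ico 1 (m + 1)) : jump e (t n) = F n (t n) - F (n - 1) (t n) := by
  rw [Finset.mem_Ico] at hn
  obtain ⟨k, rfl⟩ : ∃ k, n = k + 1 := ⟨n - 1, by omega⟩
  rw [jump, tracePlus, traceMinus, Nat.add_sub_cancel,
    rightLim_eq_of_eqOn (ht _ hn.2) (hF _ hn.2) (he _ hn.2),
    leftLim_eq_of_eqOn (ht k (by omega)) (hF k (by omega)) (he k (by omega))]

theorem energyNorm_eq_sqrt_brokenEnergy {P L K : Matrix (Fin d) (Fin d) ℝ} (hP : P.PosDef)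
    (hK : K.PosDef) {T : ℝ} {m : ℕ} {t : ℕ → ℝ} (ht : IsPartition T (m + 1) t)
    {F : ℕ → ℝ → State d}
    (hF : ∀ n < m + 1, ContinuousOn (F n) (Icc (t n) (t (n + 1)))) {e : ℝ → State d}
    (he : ∀ n < m + 1, EqOn e (F n) (Ioo (t n) (t (n + 1)))) :
    energyNorm P L K T (m + 1) t e = Real.sqrt (brokenEnergy P L K m t F) := by
  have hS := Ktilde_posSemidef hP hK
  rw [energyNorm, brokenEnergy]
  simp only [norm_act_msqrt_sq hS]
  congr 1
  have h0 : tracePlus e 0 = F 0 (t 0) := by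
    have h := rightLim_eq_of_eqOn (ht.lt 0 (by omega)) (hF 0 (by omega)) (he 0 (by omega))
    rw [← h, tracePlus, ht.zero]
  have hT : traceMinus e T = F m (t (m + 1)) := by
    have h := leftLim_eq_of_eqOn (ht.lt m (by omega)) (hF m (by omega)) (he m (by omega))
    rw [← h, traceMinus, ht.last]
  rw [h0, hT]
  congr 1
  congr 1
  · congr 1
    refine Finset.sum_congr rfl fun n hn => ?_
    rw [Finset.mem_range] at hn
    rw [intervalIntegral.integral_of_le (ht.lt n hn).le, integral_Ioc_eq_integral_Ioo,
      integral_Ioc_eq_integral_Ioo]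
    refine setIntegral_congr_fun measurableSet_Ioo fun τ hτ => ?_
    rw [he n hn hτ]
  · congr 1
    refine Finset.sum_congr rfl fun n hn => ?_
    rw [jump_eq ht.lt hF he hn]

/-! ### The two forms slab by slab -/

theorem formA_eq (P L K : Matrix (Fin d) (Fin d) ℝ) {m : ℕ} {t : ℕ → ℝ} (h0 : t 0 = 0)
    (ht : ∀ n < m + 1, t n < t (n + 1)) {p q : ℕ → Fin d ⊕ Fin d → ℝ[X]} {v w : ℝ → State d}
    (hv : ∀ n < m + 1, EqOn v (evalVec (p n)) (Ioo (t n) (t (n + 1))))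
    (hw : ∀ n < m + 1, EqOn w (evalVec (q n)) (Ioo (t n) (t (n + 1)))) :
    formA P L K (m + 1) t v w =
      (∑ n ∈ Finset.range (m + 1),
        ((∫ τ in t n..t (n + 1),
            bform (Ktilde P K) (evalVec (fun i => derivative (p n i)) τ) (evalVec (q n) τ)) +
          ∫ τ in t n..t (n + 1), bform (Amat L K) (evalVec (p n) τ) (evalVec (q n) τ))) +
        (∑ n ∈ Finset.Ico 1 (m + 1), bform (Ktilde P K)
          (evalVec (p n) (t n) - evalVec (p (n - 1)) (t n)) (evalVec (q n) (t n))) +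
        bform (Ktilde P K) (evalVec (p 0) (t 0)) (evalVec (q 0) (t 0)) := by
  have hcv : ∀ n < m + 1, ContinuousOn (evalVec (p n)) (Icc (t n) (t (n + 1))) := fun n _ =>
    (continuous_evalVec _).continuousOn
  have hcw : ∀ n < m + 1, ContinuousOn (evalVec (q n)) (Icc (t n) (t (n + 1))) := fun n _ =>
    (continuous_evalVec _).continuousOn
  have hpos : 0 < m + 1 := m.succ_pos
  rw [formA]
  congr 1
  · congr 1
    · refine Finset.sum_congr rfl fun n hn => ?_
      rw [Finset.mem_range] at hn
      rw [intervalIntegral.integral_of_le (ht n hn).le, intervalIntegral.integral_of_le (ht n hn).le]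
      simp only [integral_Ioc_eq_integral_Ioo]
      congr 1
      · refine setIntegral_congr_fun measurableSet_Ioo fun τ hτ => ?_
        simp only [bform, hw n hn hτ, deriv_eq_of_eqOn (hv n hn) hτ]
      · refine setIntegral_congr_fun measurableSet_Ioo fun τ hτ => ?_
        simp only [bform, hw n hn hτ, hv n hn hτ]
    · refine Finset.sum_congr rfl fun n hn => ?_
      have hn' := (Finset.mem_Ico.1 hn).2
      rw [jump_eq ht hcv hv hn, tracePlus, rightLim_eq_of_eqOn (ht n hn') (hcw n hn') (hw n hn'),
        bform]
  · rw [← h0, tracePlus, tracePlus, rightLim_eq_of_eqOn (ht 0 hpos) (hcv 0 hpos) (hv 0 hpos),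
      rightLim_eq_of_eqOn (ht 0 hpos) (hcw 0 hpos) (hw 0 hpos), bform]

theorem intervalIntegrable_bform {a b : ℝ} (B : BlockMat d) {x : ℝ → State d}
    (h : ∀ i, IntervalIntegrable (fun τ => x τ i) volume a b) (q : Fin d ⊕ Fin d → ℝ[X]) :
    IntervalIntegrable (fun τ => bform B (x τ) (evalVec q τ)) volume a b := by
  simp only [bform_eq_sum]
  have h1 : ∀ i j, IntervalIntegrable (fun τ => B i j * (x τ j * evalVec q τ i)) volume a b :=
    fun i j => ((h j).mul_continuousOn (Polynomial.continuous (q i)).continuousOn).const_mul _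
  have h2 : ∀ i, IntervalIntegrable (fun τ => ∑ j, B i j * (x τ j * evalVec q τ i))
      volume a b := fun i => by
    have := IntervalIntegrable.sum Finset.univ (fun j _ => h1 i j)
    rwa [Finset.sum_fn] at this
  have := IntervalIntegrable.sum Finset.univ (fun i _ => h2 i)
  rwa [Finset.sum_fn] at this

/-- Consistency: the differential equation holds almost everywhere and replaces the load. No jump
terms appear, because `z` is continuous. -/
theorem formF_eq {P L K : Matrix (Fin d) (Fin d) ℝ} {f : ℝ → EuclideanSpace ℝ (Fin d)}
    {u₀ u₁ : EuclideanSpace ℝ (Fin d)} {m : ℕ} {t : ℕ → ℝ} (h0 : t 0 = 0)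
    (ht : ∀ n < m + 1, t n < t (n + 1)) {z z' : ℝ → State d} (hz0 : z 0 = pair u₀ u₁)
    (hz : ∀ n < m + 1, ContinuousOn z (Icc (t n) (t (n + 1))))
    (hz' : ∀ n < m + 1, ∀ i, IntervalIntegrable (fun τ => z' τ i) volume (t n) (t (n + 1)))
    (heq : ∀ n < m + 1, ∀ᵐ τ ∂(volume.restrict (Ioo (t n) (t (n + 1)))),
      act (Ktilde P K) (z' τ) + act (Amat L K) (z τ) = pair 0 (f τ))
    {q : ℕ → Fin d ⊕ Fin d → ℝ[X]} {w : ℝ → State d}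
    (hw : ∀ n < m + 1, EqOn w (evalVec (q n)) (Ioo (t n) (t (n + 1)))) :
    formF P K f u₀ u₁ (m + 1) t w =
      (∑ n ∈ Finset.range (m + 1),
        ((∫ τ in t n..t (n + 1), bform (Ktilde P K) (z' τ) (evalVec (q n) τ)) +
          ∫ τ in t n..t (n + 1), bform (Amat L K) (z τ) (evalVec (q n) τ))) +
        bform (Ktilde P K) (z (t 0)) (evalVec (q 0) (t 0)) := by
  have hcw : ∀ n < m + 1, ContinuousOn (evalVec (q n)) (Icc (t n) (t (n + 1))) := fun n _ =>
    (continuous_evalVec _).continuousOn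
  have hpos : 0 < m + 1 := m.succ_pos
  rw [formF]
  congr 1
  · refine Finset.sum_congr rfl fun n hn => ?_
    rw [Finset.mem_range] at hn
    have hzi : ∀ i, IntervalIntegrable (fun τ => z τ i) volume (t n) (t (n + 1)) := fun i => by
      refine ContinuousOn.intervalIntegrable ?_
      rw [uIcc_of_le (ht n hn).le]
      exact (EuclideanSpace.proj i : State d →L[ℝ] ℝ).continuous.comp_continuousOn (hz n hn)
    rw [← intervalIntegral.integral_add (intervalIntegrable_bform _ (hz' n hn) _)
      (intervalIntegrable_bform _ hzi _), intervalIntegral.integral_of_le (ht n hn).le]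
    simp only [integral_Ioc_eq_integral_Ioo]
    refine integral_congr_ae ?_
    filter_upwards [heq n hn, ae_restrict_mem measurableSet_Ioo] with τ h1 h2
    rw [← h1, hw n hn h2, bform, bform, inner_add_left]
  · rw [← hz0, tracePlus, ← h0, rightLim_eq_of_eqOn (ht 0 hpos) (hcw 0 hpos) (hw 0 hpos), bform]

/-- The function which is `evalVec (p n)` on the slab `(t n, t (n + 1)]`, `n < N`. -/
def glue (N : ℕ) (t : ℕ → ℝ) (p : ℕ → Fin d ⊕ Fin d → ℝ[X]) (τ : ℝ) : State d :=
  ∑ n ∈ Finset.range N, (Ioc (t n) (t (n + 1))).indicator (evalVec (p n)) τ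

theorem partition_mono {N : ℕ} {t : ℕ → ℝ} (ht : ∀ n < N, t n < t (n + 1)) {k n : ℕ} (hkn : k ≤ n)
    (hn : n ≤ N) : t k ≤ t n := by
  induction n, hkn using Nat.le_induction with
  | base => exact le_rfl
  | succ n hkn ih => exact (ih (by omega)).trans (ht n (by omega)).le

theorem glue_eq {N : ℕ} {t : ℕ → ℝ} (ht : ∀ n < N, t n < t (n + 1))
    (p : ℕ → Fin d ⊕ Fin d → ℝ[X]) {n : ℕ} (hn : n < N) :
    EqOn (glue N t p) (evalVec (p n)) (Ioc (t n) (t (n + 1))) := by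
  intro τ hτ
  rw [glue, Finset.sum_eq_single n]
  · exact indicator_of_mem hτ _
  · intro k hk hkn
    rw [Finset.mem_range] at hk
    refine indicator_of_notMem (fun h => ?_) _
    rcases lt_or_gt_of_ne hkn with h1 | h1
    · exact absurd (h.2.trans (partition_mono ht h1 hn.le)) (not_le.2 hτ.1)
    · exact absurd (hτ.2.trans (partition_mono ht h1 hk.le)) (not_le.2 h.1)
  · exact fun h => absurd (Finset.mem_range.2 hn) h

/-- The discrete part of the error is controlled by the traces of the projection error. -/
theorem brokenEnergy_le_of_isDGSolution {P L K : Matrix (Fin d) (Fin d) ℝ} (hP : P.PosDef)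
    (hL : L.PosDef) (hK : K.PosDef) {f : ℝ → EuclideanSpace ℝ (Fin d)}
    {u₀ u₁ : EuclideanSpace ℝ (Fin d)} {m : ℕ} {t : ℕ → ℝ} (h0 : t 0 = 0)
    (ht : ∀ n < m + 1, t n < t (n + 1)) {z z' : ℝ → State d} (hz0 : z 0 = pair u₀ u₁)
    (hz : ∀ n < m + 1, ContinuousOn z (Icc (t n) (t (n + 1))))
    (hz' : ∀ n < m + 1, ∀ i, IntervalIntegrable (fun τ => z' τ i) volume (t n) (t (n + 1)))
    (hprim : ∀ n < m + 1, ∀ i, ∀ x ∈ Icc (t n) (t (n + 1)),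
      z x i = z (t n) i + ∫ τ in t n..x, z' τ i)
    (heq : ∀ n < m + 1, ∀ᵐ τ ∂(volume.restrict (Ioo (t n) (t (n + 1)))),
      act (Ktilde P K) (z' τ) + act (Amat L K) (z τ) = pair 0 (f τ))
    {r : ℕ → ℕ} {zDG : ℝ → State d} (hDG : IsDGSolution P L K f u₀ u₁ (m + 1) t r zDG)
    {y : ℕ → Fin d ⊕ Fin d → ℝ[X]} (hyd : ∀ n < m + 1, ∀ i, (y n i).natDegree ≤ r n)
    (hy : ∀ n < m + 1, EqOn zDG (evalVec (y n)) (Ioo (t n) (t (n + 1)))) :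
    brokenEnergy P L K m t
        (fun n => evalVec fun i => vecProj (t n) (t (n + 1)) (r n) z i - y n i) ≤
      2 * ∑ n ∈ Finset.range (m + 1), bform (Ktilde P K)
        (z (t (n + 1)) - evalVec (vecProj (t n) (t (n + 1)) (r n) z) (t (n + 1)))
        (z (t (n + 1)) - evalVec (vecProj (t n) (t (n + 1)) (r n) z) (t (n + 1))) := by
  have hS := Ktilde_posSemidef hP hK
  set w : ℕ → Fin d ⊕ Fin d → ℝ[X] := fun n => vecProj (t n) (t (n + 1)) (r n) z with hw
  set θ : ℕ → Fin d ⊕ Fin d → ℝ[X] := fun n i => w n i - y n i with hθ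
  have hθd : ∀ n < m + 1, ∀ i, (θ n i).natDegree ≤ r n := fun n hn i =>
    (natDegree_sub_le _ _).trans (max_le (natDegree_polyProj_le _ _ _ _) (hyd n hn i))
  have hglue : ∀ n < m + 1, EqOn (glue (m + 1) t θ) (evalVec (θ n)) (Ioo (t n) (t (n + 1))) :=
    fun n hn => (glue_eq ht θ hn).mono Ioo_subset_Ioc_self
  -- The test function is the discrete error itself.
  have hdg := hDG.eqn (glue (m + 1) t θ) (fun n hn => ⟨θ n, hθd n hn, fun τ hτ i => by
    rw [glue_eq ht θ hn hτ]; rfl⟩)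
  rw [formA_eq P L K h0 ht hy hglue, formF_eq h0 ht hz0 hz hz' heq hglue] at hdg
  have hθv : ∀ n τ, evalVec (θ n) τ = evalVec (w n) τ - evalVec (y n) τ := fun n τ =>
    evalVec_sub _ _ _
  -- The exact solution enters through its projection plus traces of the projection error. Writing
  -- the projection as `z_DG + θ`, the `θ` part gives the difference of the `K̃` energies at the two
  -- ends and the dissipation.
  have hslab : ∀ n ∈ Finset.range (m + 1),
      (∫ τ in t n..t (n + 1), bform (Ktilde P K) (z' τ) (evalVec (θ n) τ)) +
          (∫ τ in t n..t (n + 1), bform (Amat L K) (z τ) (evalVec (θ n) τ)) =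
        ((∫ τ in t n..t (n + 1),
            bform (Ktilde P K) (evalVec (fun i => derivative (y n i)) τ) (evalVec (θ n) τ)) +
          ∫ τ in t n..t (n + 1), bform (Amat L K) (evalVec (y n) τ) (evalVec (θ n) τ)) +
        (1 / 2 * (bform (Ktilde P K) (evalVec (θ n) (t (n + 1))) (evalVec (θ n) (t (n + 1))) -
            bform (Ktilde P K) (evalVec (θ n) (t n)) (evalVec (θ n) (t n))) +
          (∫ τ in t n..t (n + 1), ‖act (Ltilde L) (evalVec (θ n) τ)‖ ^ 2) +
          (bform (Ktilde P K) (z (t (n + 1)) - evalVec (w n) (t (n + 1)))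
              (evalVec (θ n) (t (n + 1))) -
            bform (Ktilde P K) (z (t n) - evalVec (w n) (t n)) (evalVec (θ n) (t n)))) := by
    intro n hn
    rw [Finset.mem_range] at hn
    rw [integral_bform_deriv_eq (ht n hn) _ (hz n hn) (hz' n hn) (hprim n hn) (hθd n hn),
      integral_bform_vecProj (ht n hn) _ (hz n hn) (hθd n hn),
      ← integral_bform_self_derivative hS.1]
    simp only [← bform_Amat_self hL.posSemidef hK.posSemidef.1]
    have e1 : ∀ τ, bform (Ktilde P K) (evalVec (fun i => derivative (w n i)) τ) (evalVec (θ n) τ) =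
        bform (Ktilde P K) (evalVec (fun i => derivative (y n i)) τ) (evalVec (θ n) τ) +
        bform (Ktilde P K) (evalVec (fun i => derivative (θ n i)) τ) (evalVec (θ n) τ) := by
      intro τ
      rw [← bform_add_left]
      congr 1
      ext i
      simp [hθ, evalVec]
    have e2 : ∀ τ, bform (Amat L K) (evalVec (w n) τ) (evalVec (θ n) τ) =
        bform (Amat L K) (evalVec (y n) τ) (evalVec (θ n) τ) +
        bform (Amat L K) (evalVec (θ n) τ) (evalVec (θ n) τ) := by
      intro τ
      rw [← bform_add_left, hθv, add_sub_cancel]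
    have hc : ∀ (B : BlockMat d) (p q : Fin d ⊕ Fin d → ℝ[X]), IntervalIntegrable
        (fun τ => bform B (evalVec p τ) (evalVec q τ)) volume (t n) (t (n + 1)) :=
      fun B p q => (continuous_bform_evalVec B p q).intervalIntegrable _ _
    change (∫ τ in t n..t (n + 1), bform (Ktilde P K) (evalVec (fun i => derivative (w n i)) τ)
      (evalVec (θ n) τ)) + _ +
      (∫ τ in t n..t (n + 1), bform (Amat L K) (evalVec (w n) τ) (evalVec (θ n) τ)) = _
    simp only [e1, e2]
    rw [intervalIntegral.integral_add (hc _ _ _) (hc _ _ _),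
      intervalIntegral.integral_add (hc _ _ _) (hc _ _ _)]
    ring
  rw [Finset.sum_congr rfl hslab, Finset.sum_add_distrib, Finset.sum_add_distrib,
    Finset.sum_add_distrib, Finset.sum_add_distrib, Finset.sum_add_distrib] at hdg
  have hid := trace_identity hS.1 (fun n => z (t n) - evalVec (w n) (t n))
    (fun n => z (t (n + 1)) - evalVec (w n) (t (n + 1))) (fun n => evalVec (θ n) (t n))
    (fun n => evalVec (θ n) (t (n + 1))) m
  have hyθ : ∀ n τ, z τ - evalVec (w n) τ + evalVec (θ n) τ = z τ - evalVec (y n) τ := fun n τ => by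
    rw [hθv]; abel
  simp only [hyθ] at hid
  -- The right end of slab `n - 1` appears as `t (n - 1 + 1)`, which is `t n` only for `n ≥ 1`; the
  -- sums start at `1`.
  have hIco : ∀ g : ℕ → ℕ → ℝ, ∑ n ∈ Finset.Ico 1 (m + 1), g n (n - 1 + 1) =
      ∑ n ∈ Finset.Ico 1 (m + 1), g n n := fun g => Finset.sum_congr rfl fun n hn => by
    rw [Nat.sub_add_cancel (Finset.mem_Ico.1 hn).1]
  have i1 := hIco fun n k => bform (Ktilde P K)
    (z (t k) - evalVec (y (n - 1)) (t k) - (z (t n) - evalVec (y n) (t n))) (evalVec (θ n) (t n))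
  have i2 := hIco fun n k => bform (Ktilde P K)
    (evalVec (θ n) (t n) - evalVec (θ (n - 1)) (t k))
    (evalVec (θ n) (t n) - evalVec (θ (n - 1)) (t k))
  rw [i1, i2] at hid
  -- The two values of `z` at the node cancel, and the jump of the error becomes minus the jump of
  -- `z_DG`.
  simp only [sub_sub_sub_cancel_left] at hid
  rw [bform_sub_left _ (z (t 0))] at hid
  have hyoung : (∑ n ∈ Finset.Ico 1 (m + 1), bform (Ktilde P K)
      (z (t (n - 1 + 1)) - evalVec (w (n - 1)) (t (n - 1 + 1)))
      (evalVec (θ n) (t n) - evalVec (θ (n - 1)) (t (n - 1 + 1)))) ≤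
      (∑ n ∈ Finset.Ico 1 (m + 1), bform (Ktilde P K)
        (z (t (n - 1 + 1)) - evalVec (w (n - 1)) (t (n - 1 + 1)))
        (z (t (n - 1 + 1)) - evalVec (w (n - 1)) (t (n - 1 + 1)))) +
      1 / 4 * ∑ n ∈ Finset.Ico 1 (m + 1), bform (Ktilde P K)
        (evalVec (θ n) (t n) - evalVec (θ (n - 1)) (t n))
        (evalVec (θ n) (t n) - evalVec (θ (n - 1)) (t n)) := by
    rw [← i2, Finset.mul_sum, ← Finset.sum_add_distrib]
    exact Finset.sum_le_sum fun n _ => bform_le hS _ _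
  have hshift : (∑ n ∈ Finset.Ico 1 (m + 1), bform (Ktilde P K)
        (z (t (n - 1 + 1)) - evalVec (w (n - 1)) (t (n - 1 + 1)))
        (z (t (n - 1 + 1)) - evalVec (w (n - 1)) (t (n - 1 + 1)))) =
      ∑ n ∈ Finset.range m, bform (Ktilde P K)
        (z (t (n + 1)) - evalVec (w n) (t (n + 1))) (z (t (n + 1)) - evalVec (w n) (t (n + 1))) := by
    rw [Finset.sum_Ico_eq_sum_range]
    simp only [Nat.add_sub_cancel, Nat.add_sub_cancel_left]
  -- The final trace term carries a minus sign, hence Young's inequality is applied to `-θ`.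
  have hlast := bform_le hS (z (t (m + 1)) - evalVec (w m) (t (m + 1)))
    (-evalVec (θ m) (t (m + 1)))
  have hneg : -evalVec (θ m) (t (m + 1)) = (-1 : ℝ) • evalVec (θ m) (t (m + 1)) := by simp
  rw [hneg, bform_smul_right, bform_smul_right, bform_smul_left] at hlast
  have hJ : 0 ≤ ∑ n ∈ Finset.Ico 1 (m + 1), bform (Ktilde P K)
        (evalVec (θ n) (t n) - evalVec (θ (n - 1)) (t n))
        (evalVec (θ n) (t n) - evalVec (θ (n - 1)) (t n)) :=
    Finset.sum_nonneg fun n _ => bform_self_nonneg hS _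
  have hi0 := bform_self_nonneg hS (evalVec (θ 0) (t 0))
  have hD : 0 ≤ ∑ n ∈ Finset.range (m + 1),
      ∫ τ in t n..t (n + 1), ‖act (Ltilde L) (evalVec (θ n) τ)‖ ^ 2 :=
    Finset.sum_nonneg fun n hn => intervalIntegral.integral_nonneg
      (ht n (Finset.mem_range.1 hn)).le fun τ _ => sq_nonneg _
  rw [hshift] at hyoung
  rw [brokenEnergy, Finset.sum_range_succ (fun n => bform (Ktilde P K)
        (z (t (n + 1)) - evalVec (w n) (t (n + 1))) (z (t (n + 1)) - evalVec (w n) (t (n + 1))))]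
  change (∑ n ∈ Finset.range (m + 1),
      ∫ τ in t n..t (n + 1), ‖act (Ltilde L) (evalVec (θ n) τ)‖ ^ 2) +
      1 / 2 * bform (Ktilde P K) (evalVec (θ 0) (t 0)) (evalVec (θ 0) (t 0)) +
      1 / 2 * (∑ n ∈ Finset.Ico 1 (m + 1), bform (Ktilde P K)
        (evalVec (θ n) (t n) - evalVec (θ (n - 1)) (t n))
        (evalVec (θ n) (t n) - evalVec (θ (n - 1)) (t n))) +
      1 / 2 * bform (Ktilde P K) (evalVec (θ m) (t (m + 1))) (evalVec (θ m) (t (m + 1))) ≤ _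
  -- Young leaves a quarter of the jump and final terms of `θ` on the right, at most half of its
  -- squared energy; absorbing it produces the factor `2`.
  linarith

/-- A jump of `F` is split into its two traces, so each trace carries at most `1/2 * 2 * 2 = 2`; the
first and the last trace need only `1`. The jumps of `G` are kept intact, as they are already
controlled by its energy. -/
theorem brokenEnergy_add_le {P L K : Matrix (Fin d) (Fin d) ℝ} (hP : P.PosDef) (hK : K.PosDef)
    {m : ℕ} {t : ℕ → ℝ} (ht : ∀ n < m + 1, t n < t (n + 1)) {F G : ℕ → ℝ → State d}
    (hF : ∀ n < m + 1, ContinuousOn (F n) (Icc (t n) (t (n + 1))))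
    (hG : ∀ n < m + 1, ContinuousOn (G n) (Icc (t n) (t (n + 1)))) :
    brokenEnergy P L K m t (fun n τ => F n τ + G n τ) ≤
      2 * (∑ n ∈ Finset.range (m + 1),
        ((∫ τ in t n..t (n + 1), ‖act (Ltilde L) (F n τ)‖ ^ 2) +
          bform (Ktilde P K) (F n (t n)) (F n (t n)) +
          bform (Ktilde P K) (F n (t (n + 1))) (F n (t (n + 1))))) +
      2 * brokenEnergy P L K m t G := by
  have hS := Ktilde_posSemidef hP hK
  have h1 : ∑ n ∈ Finset.range (m + 1),
      ∫ τ in t n..t (n + 1), ‖act (Ltilde L) (F n τ + G n τ)‖ ^ 2 ≤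
      2 * (∑ n ∈ Finset.range (m + 1), ∫ τ in t n..t (n + 1), ‖act (Ltilde L) (F n τ)‖ ^ 2) +
      2 * ∑ n ∈ Finset.range (m + 1), ∫ τ in t n..t (n + 1), ‖act (Ltilde L) (G n τ)‖ ^ 2 := by
    rw [Finset.mul_sum, Finset.mul_sum, ← Finset.sum_add_distrib]
    refine Finset.sum_le_sum fun n hn => ?_
    rw [Finset.mem_range] at hn
    have hle := (ht n hn).le
    have hc : ∀ {H : ℝ → State d}, ContinuousOn H (Icc (t n) (t (n + 1))) → IntervalIntegrable
        (fun τ => ‖act (Ltilde L) (H τ)‖ ^ 2) volume (t n) (t (n + 1)) := fun hH => by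
      refine ContinuousOn.intervalIntegrable ?_
      rw [uIcc_of_le hle]
      exact ((continuous_act _).comp_continuousOn hH).norm.pow 2
    rw [← intervalIntegral.integral_const_mul, ← intervalIntegral.integral_const_mul,
      ← intervalIntegral.integral_add ((hc (hF n hn)).const_mul 2) ((hc (hG n hn)).const_mul 2)]
    refine intervalIntegral.integral_mono_on hle (hc ((hF n hn).add (hG n hn)))
      (((hc (hF n hn)).const_mul 2).add ((hc (hG n hn)).const_mul 2)) fun τ _ => ?_
    rw [act_add]
    have := norm_add_le (act (Ltilde L) (F n τ)) (act (Ltilde L) (G n τ))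
    nlinarith [norm_nonneg (act (Ltilde L) (F n τ) + act (Ltilde L) (G n τ)),
      sq_nonneg (‖act (Ltilde L) (F n τ)‖ - ‖act (Ltilde L) (G n τ)‖)]
  have h2 := bform_add_self_le hS (F 0 (t 0)) (G 0 (t 0))
  have h3 := bform_add_self_le hS (F m (t (m + 1))) (G m (t (m + 1)))
  have h4 : (∑ n ∈ Finset.Ico 1 (m + 1), bform (Ktilde P K)
      (F n (t n) + G n (t n) - (F (n - 1) (t n) + G (n - 1) (t n)))
      (F n (t n) + G n (t n) - (F (n - 1) (t n) + G (n - 1) (t n)))) ≤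
      4 * (∑ n ∈ Finset.Ico 1 (m + 1), bform (Ktilde P K) (F n (t n)) (F n (t n))) +
      4 * (∑ n ∈ Finset.Ico 1 (m + 1), bform (Ktilde P K) (F (n - 1) (t n)) (F (n - 1) (t n))) +
      2 * ∑ n ∈ Finset.Ico 1 (m + 1), bform (Ktilde P K)
        (G n (t n) - G (n - 1) (t n)) (G n (t n) - G (n - 1) (t n)) := by
    rw [Finset.mul_sum, Finset.mul_sum, Finset.mul_sum, ← Finset.sum_add_distrib,
      ← Finset.sum_add_distrib]
    refine Finset.sum_le_sum fun n _ => ?_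
    rw [add_sub_add_comm]
    have h5 := bform_add_self_le hS (F n (t n) - F (n - 1) (t n)) (G n (t n) - G (n - 1) (t n))
    have h6 := bform_sub_self_le hS (F n (t n)) (F (n - 1) (t n))
    linarith
  have h5 : (∑ n ∈ Finset.range (m + 1), bform (Ktilde P K) (F n (t n)) (F n (t n))) =
      (∑ n ∈ Finset.Ico 1 (m + 1), bform (Ktilde P K) (F n (t n)) (F n (t n))) +
        bform (Ktilde P K) (F 0 (t 0)) (F 0 (t 0)) := by
    rw [Finset.sum_range_succ', Finset.sum_Ico_eq_sum_range]
    simp only [Nat.add_sub_cancel, add_comm 1]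
  have h6 : (∑ n ∈ Finset.range (m + 1),
        bform (Ktilde P K) (F n (t (n + 1))) (F n (t (n + 1)))) =
      (∑ n ∈ Finset.Ico 1 (m + 1), bform (Ktilde P K) (F (n - 1) (t n)) (F (n - 1) (t n))) +
        bform (Ktilde P K) (F m (t (m + 1))) (F m (t (m + 1))) := by
    rw [Finset.sum_range_succ, Finset.sum_Ico_eq_sum_range]
    simp only [Nat.add_sub_cancel, add_comm 1]
  have h7 := bform_self_nonneg hS (F 0 (t 0))
  have h8 := bform_self_nonneg hS (F m (t (m + 1)))
  rw [Finset.sum_add_distrib, Finset.sum_add_distrib, h5, h6]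
  simp only [brokenEnergy]
  linarith

end Energy

end TimeDG

end

noncomputable section

namespace TimeDG

/-! ### The error estimate -/

section Estimate

variable {d : ℕ}

/-- The squared error of the `L²` projection on a slab: both traces and the `L²` norm. -/
def slabError (a b : ℝ) (n : ℕ) (z : ℝ → State d) : ℝ :=
  ‖z b - evalVec (vecProj a b n z) b‖ ^ 2 + ‖z a - evalVec (vecProj a b n z) a‖ ^ 2 +
    ∫ τ in a..b, ‖z τ - evalVec (vecProj a b n z) τ‖ ^ 2

theorem continuousOn_apply {s : Set ℝ} {z : ℝ → State d} (hz : ContinuousOn z s)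
    (i : Fin d ⊕ Fin d) : ContinuousOn (fun τ => z τ i) s :=
  (EuclideanSpace.proj i : State d →L[ℝ] ℝ).continuous.comp_continuousOn hz

theorem slabError_le {a b : ℝ} (hab : a < b) {r μ : ℕ} (hμ : μ ≤ r) {z : ℝ → State d}
    (hz : ContinuousOn z (Icc a b)) {g : ℕ → ℝ → State d}
    (hg : ∀ j ≤ μ + 1, IsWeakDeriv j a b z (g j))
    (hL : ∀ j ≤ μ + 1, MemLp (g j) 2 (volume.restrict (Ioo a b))) :
    slabError a b r z ≤ 5 * ((b - a) / 2) ^ (2 * μ + 1) / legendreFactor r μ *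
      ∑ j ∈ Finset.range (μ + 2), ∫ τ in Ioo a b, ‖g j τ‖ ^ 2 := by
  have hcomp : ∀ i, _ := fun i => polyProj_error_le hab hμ (continuousOn_apply hz i)
    (g := fun j τ => g j τ i) (fun j hj => (hg j hj).apply i) (fun j hj => (hL j hj).eval_piLp i)
  have hsum := Finset.sum_le_sum fun i (_ : i ∈ Finset.univ) => hcomp i
  rw [← Finset.mul_sum, Finset.sum_comm, Finset.sum_add_distrib, Finset.sum_add_distrib] at hsum
  have h1 : slabError a b r z = (∑ i, (z b i - (polyProj a b r fun τ => z τ i).eval b) ^ 2) +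
      (∑ i, (z a i - (polyProj a b r fun τ => z τ i).eval a) ^ 2) +
      ∑ i, ∫ τ in a..b, (z τ i - (polyProj a b r fun τ => z τ i).eval τ) ^ 2 := by
    simp only [slabError, EuclideanSpace.real_norm_sq_eq, PiLp.sub_apply, evalVec_apply, vecProj]
    congr 1
    refine intervalIntegral.integral_finsetSum fun i _ => ?_
    refine ContinuousOn.intervalIntegrable ?_
    rw [uIcc_of_le hab.le]
    exact ((continuousOn_apply hz i).sub (Polynomial.continuous _).continuousOn).pow 2
  have h2 : ∑ j ∈ Finset.range (μ + 2), ∫ τ in Ioo a b, ‖g j τ‖ ^ 2 =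
      ∑ j ∈ Finset.range (μ + 2), ∑ i, ∫ τ in a..b, g j τ i ^ 2 := by
    refine Finset.sum_congr rfl fun j hj => ?_
    have hj' : j ≤ μ + 1 := by rw [Finset.mem_range] at hj; omega
    simp only [EuclideanSpace.real_norm_sq_eq]
    rw [integral_finsetSum _ fun i _ => ((hL j hj').eval_piLp i).integrable_sq]
    refine Finset.sum_congr rfl fun i _ => ?_
    rw [intervalIntegral.integral_of_le hab.le, integral_Ioc_eq_integral_Ioo]
  rw [h1, h2]
  exact hsum

/-! ### From the slab error to the Sobolev norm -/

theorem hpFactor_pos {h : ℝ} (hh : 0 < h) (r μ : ℕ) : 0 < hpFactor h r μ := by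
  unfold hpFactor; positivity

/-- The quotient of factorials is the reciprocal of `legendreFactor`, and the factor `r + 2` is at
least `1`. -/
theorem hpFactor_sq_ge {h : ℝ} (hh : 0 < h) {r μ : ℕ} (hμ : μ ≤ r) :
    (h / 2) ^ (2 * μ + 1) / legendreFactor r μ ≤ hpFactor h r μ ^ 2 := by
  have hh2 : 0 < h / 2 := by positivity
  have h1 : (((h / 2) ^ ((μ : ℝ) + 1 / 2)) ^ 2 : ℝ) = (h / 2) ^ (2 * μ + 1) := by
    rw [← Real.rpow_natCast, ← Real.rpow_mul hh2.le, ← Real.rpow_natCast]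
    congr 1; push_cast; ring
  have hc := legendreFactor_pos hμ
  have h2 : ((r - μ).factorial : ℝ) / ((r + μ).factorial : ℝ) = 1 / legendreFactor r μ := by
    rw [← legendreFactor_mul_factorial hμ]
    have : ((r - μ).factorial : ℝ) ≠ 0 := by positivity
    field_simp
  rw [hpFactor, mul_pow, h1, Real.sq_sqrt (by positivity), h2, div_eq_mul_one_div]
  refine mul_le_mul_of_nonneg_left ?_ (by positivity)
  have : (0 : ℝ) ≤ r := by positivity
  have h3 : 0 < 1 / legendreFactor r μ := by positivity
  nlinarith

theorem eLpNorm_two_sq {E : Type*} [NormedAddCommGroup E] {f : ℝ → E} {ν : Measure ℝ}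
    (hf : MemLp f 2 ν) : eLpNorm f 2 ν ^ 2 = ENNReal.ofReal (∫ x, ‖f x‖ ^ 2 ∂ν) := by
  have h0 : 0 ≤ ∫ x, ‖f x‖ ^ 2 ∂ν := integral_nonneg fun _ => by positivity
  rw [hf.eLpNorm_eq_integral_rpow_norm (by norm_num) (by norm_num)]
  simp only [ENNReal.toReal_ofNat, Real.rpow_ofNat]
  rw [← ENNReal.ofReal_pow (by positivity), ← Real.rpow_natCast, ← Real.rpow_mul h0]
  norm_num

theorem sqrt_slabError_le {a b : ℝ} (hab : a < b) {r μ : ℕ} (hμ : μ ≤ r) {z : ℝ → State d}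
    (hz : ContinuousOn z (Icc a b)) :
    ENNReal.ofReal (Real.sqrt (slabError a b r z)) ≤
      ENNReal.ofReal (3 * hpFactor (b - a) r μ) * sobolevNorm (μ + 1) a b z := by
  have hba : 0 < b - a := sub_pos.2 hab
  have hhp := hpFactor_pos hba r μ
  have hβ : ENNReal.ofReal (3 * hpFactor (b - a) r μ) ≠ 0 := by
    rw [Ne, ENNReal.ofReal_eq_zero, not_le]; positivity
  have hβ' : ENNReal.ofReal (3 * hpFactor (b - a) r μ) ≠ ⊤ := ENNReal.ofReal_ne_top
  -- The factor is finite and nonzero, so it can be moved across the infimum, and each admissible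
  -- family is treated separately. The `3` comes from `5 ≤ 3 ^ 2`.
  rw [mul_comm, ← ENNReal.div_le_iff_le_mul (Or.inl hβ) (Or.inl hβ'), sobolevNorm]
  refine le_iInf₂ fun g hg => ?_
  rw [ENNReal.div_le_iff_le_mul (Or.inl hβ) (Or.inl hβ'), mul_comm]
  by_cases hfin : ∀ j ≤ μ + 1, eLpNorm (g j) 2 (volume.restrict (Ioo a b)) < ⊤
  · have hL : ∀ j ≤ μ + 1, MemLp (g j) 2 (volume.restrict (Ioo a b)) := fun j hj =>
      ⟨(hg j hj).2.1.aestronglyMeasurable, hfin j hj⟩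
    have hle := slabError_le hab hμ hz hg hL
    set G := ∑ j ∈ Finset.range (μ + 2), ∫ τ in Ioo a b, ‖g j τ‖ ^ 2 with hG
    have hG0 : 0 ≤ G := Finset.sum_nonneg fun j _ => integral_nonneg fun _ => by positivity
    have e1 : ∑ j ∈ Finset.range (μ + 1 + 1), eLpNorm (g j) 2 (volume.restrict (Ioo a b)) ^ 2 =
        ENNReal.ofReal G := by
      rw [hG, ENNReal.ofReal_sum_of_nonneg fun j _ => integral_nonneg fun _ => by positivity]
      refine Finset.sum_congr rfl fun j hj => eLpNorm_two_sq (hL j ?_)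
      rw [Finset.mem_range] at hj; omega
    rw [e1, ENNReal.ofReal_rpow_of_nonneg hG0 (by norm_num), ← Real.sqrt_eq_rpow,
      ← ENNReal.ofReal_mul (by positivity)]
    refine ENNReal.ofReal_le_ofReal (Real.sqrt_le_iff.2 ⟨by positivity, hle.trans ?_⟩)
    rw [mul_pow, Real.sq_sqrt hG0, mul_pow]
    refine mul_le_mul_of_nonneg_right ?_ hG0
    have := hpFactor_sq_ge hba hμ
    rw [mul_div_assoc]
    nlinarith [sq_nonneg (hpFactor (b - a) r μ)]
  -- A family with a member outside `L²` has norm `∞`, and the bound is trivial.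
  · push Not at hfin
    obtain ⟨j, hj, hjt⟩ := hfin
    have e1 : ∑ j ∈ Finset.range (μ + 1 + 1), eLpNorm (g j) 2 (volume.restrict (Ioo a b)) ^ 2 =
        ⊤ := by
      rw [ENNReal.sum_eq_top]
      refine ⟨j, Finset.mem_range.2 (by omega), ?_⟩
      rw [top_le_iff.1 hjt]
      simp
    rw [e1, ENNReal.top_rpow_of_pos (by norm_num), ENNReal.mul_top hβ]
    exact le_top

theorem sqrt_sum_le_sum_sqrt {ι : Type*} (s : Finset ι) (x : ι → ℝ) (hx : ∀ i ∈ s, 0 ≤ x i) :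
    Real.sqrt (∑ i ∈ s, x i) ≤ ∑ i ∈ s, Real.sqrt (x i) := by
  refine Real.sqrt_le_iff.2 ⟨Finset.sum_nonneg fun i _ => Real.sqrt_nonneg _, ?_⟩
  calc ∑ i ∈ s, x i = ∑ i ∈ s, Real.sqrt (x i) ^ 2 :=
        Finset.sum_congr rfl fun i hi => (Real.sq_sqrt (hx i hi)).symm
    _ ≤ _ := Finset.sum_sq_le_sq_sum_of_nonneg fun i _ => Real.sqrt_nonneg _

/-- The solution is the primitive of its weak derivative on every slab. -/
theorem eq_primitive_of_subinterval {T a b : ℝ} (h0 : 0 ≤ a) (hT : b ≤ T) {v v' : ℝ → ℝ}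
    (hv' : IntervalIntegrable v' volume 0 T)
    (h : ∀ x ∈ Icc 0 T, v x = v 0 + ∫ y in (0 : ℝ)..x, v' y) :
    ∀ x ∈ Icc a b, v x = v a + ∫ y in a..x, v' y := by
  intro x hx
  have hxT : x ≤ T := hx.2.trans hT
  have h1 : IntervalIntegrable v' volume 0 a := hv'.mono_set (by
    rw [uIcc_of_le h0, uIcc_of_le (by linarith [hx.1])]
    exact Icc_subset_Icc_right (hx.1.trans hxT))
  have h2 : IntervalIntegrable v' volume a x := hv'.mono_set (by
    rw [uIcc_of_le hx.1, uIcc_of_le (by linarith [hx.1])]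
    exact Icc_subset_Icc h0 hxT)
  rw [h x ⟨h0.trans hx.1, hxT⟩, h a ⟨h0, hx.1.trans hxT⟩,
    ← intervalIntegral.integral_add_adjacent_intervals h1 h2, add_assoc]

/-- The squared energy norm of the error is bounded by the squared projection errors. -/
theorem energyNorm_error_le {P L K : Matrix (Fin d) (Fin d) ℝ} (hP : P.PosDef) (hL : L.PosDef)
    (hK : K.PosDef) {M : ℝ} (hPM : infNorm P ≤ M) (hLM : infNorm L ≤ M) (hKM : infNorm K ≤ M)
    {T : ℝ} (hT : 0 < T) {f : ℝ → EuclideanSpace ℝ (Fin d)} {u₀ u₁ : EuclideanSpace ℝ (Fin d)}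
    {z : ℝ → State d} (hz : IsSolution P L K f u₀ u₁ T z) {m : ℕ} {t : ℕ → ℝ}
    (ht : IsPartition T (m + 1) t) {r : ℕ → ℕ} {zDG : ℝ → State d}
    (hDG : IsDGSolution P L K f u₀ u₁ (m + 1) t r zDG) :
    energyNorm P L K T (m + 1) t (fun τ => z τ - zDG τ) ≤
      Real.sqrt (6 * M * ∑ n ∈ Finset.range (m + 1), slabError (t n) (t (n + 1)) (r n) z) := by
  obtain ⟨z', hw, hz'L, heq⟩ := hz.eqn
  choose! y hyd hy using hDG.mem
  have hM : 0 ≤ M := (infNorm_nonneg L).trans hLM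
  have htn : ∀ n < m + 1, 0 ≤ t n ∧ t (n + 1) ≤ T := fun n hn =>
    ⟨by rw [← ht.zero]; exact partition_mono ht.lt (Nat.zero_le n) hn.le,
      by rw [← ht.last]; exact partition_mono ht.lt (Nat.succ_le_of_lt hn) le_rfl⟩
  have hzc : ∀ n < m + 1, ContinuousOn z (Icc (t n) (t (n + 1))) := fun n hn =>
    hz.cont.mono (Icc_subset_Icc (htn n hn).1 (htn n hn).2)
  have hyev : ∀ n < m + 1, EqOn zDG (evalVec (y n)) (Ioo (t n) (t (n + 1))) := fun n hn τ hτ => by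
    ext i
    exact hy n hn τ (Ioo_subset_Ioc_self hτ) i
  have hz'i : ∀ i, IntegrableOn (fun τ => z' τ i) (Ioo 0 T) := fun i =>
    (hz'L.eval_piLp i).integrable (by norm_num)
  have hz'ii : ∀ i, IntervalIntegrable (fun τ => z' τ i) volume 0 T := fun i => by
    rw [intervalIntegrable_iff_integrableOn_Ioo_of_le hT.le]; exact hz'i i
  have hz'n : ∀ n < m + 1, ∀ i,
      IntervalIntegrable (fun τ => z' τ i) volume (t n) (t (n + 1)) := fun n hn i =>
    (hz'ii i).mono_set (by
      rw [uIcc_of_le (ht.lt n hn).le, uIcc_of_le hT.le]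
      exact Icc_subset_Icc (htn n hn).1 (htn n hn).2)
  have hprim : ∀ n < m + 1, ∀ i, ∀ x ∈ Icc (t n) (t (n + 1)),
      z x i = z (t n) i + ∫ τ in t n..x, z' τ i := fun n hn i =>
    eq_primitive_of_subinterval (v := fun τ => z τ i) (htn n hn).1 (htn n hn).2 (hz'ii i)
      ((hw.apply i).eq_primitive hT (hz'i i) (continuousOn_apply hz.cont i))
  have hkey := brokenEnergy_le_of_isDGSolution hP hL hK ht.zero ht.lt hz.init hzc hz'n hprim
    (fun n hn => ae_restrict_of_ae_restrict_of_subset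
      (Ioo_subset_Ioo (htn n hn).1 (htn n hn).2) heq) hDG hyd hyev
  set w : ℕ → Fin d ⊕ Fin d → Polynomial ℝ := fun n => vecProj (t n) (t (n + 1)) (r n) z with hwdef
  have hηc : ∀ n < m + 1, ContinuousOn (fun τ => z τ - evalVec (w n) τ)
      (Icc (t n) (t (n + 1))) := fun n hn => (hzc n hn).sub (continuous_evalVec _).continuousOn
  have hadd := brokenEnergy_add_le (P := P) (L := L) (K := K) hP hK ht.lt
    (F := fun n τ => z τ - evalVec (w n) τ) (G := fun n => evalVec fun i => w n i - y n i) hηc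
    (fun n _ => (continuous_evalVec _).continuousOn)
  have hFG : (fun (n : ℕ) (τ : ℝ) => z τ - evalVec (w n) τ + evalVec (fun i => w n i - y n i) τ) =
      fun n τ => z τ - evalVec (y n) τ := by
    funext n τ
    rw [evalVec_sub]; abel
  rw [hFG] at hadd
  rw [energyNorm_eq_sqrt_brokenEnergy hP hK ht (F := fun n τ => z τ - evalVec (y n) τ)
    (fun n hn => (hzc n hn).sub (continuous_evalVec _).continuousOn)
    (fun n hn τ hτ => by dsimp only; rw [hyev n hn hτ])]
  refine Real.sqrt_le_sqrt (hadd.trans ?_)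
  -- Right end traces occur with weight `2` from `η` and `2 * 2` from the bound for `θ`, together
  -- `6`; left end traces and the `L²` part occur only with `2`.
  have hfin : 2 * (∑ n ∈ Finset.range (m + 1),
        ((∫ τ in t n..t (n + 1), ‖act (Ltilde L) (z τ - evalVec (w n) τ)‖ ^ 2) +
          bform (Ktilde P K) (z (t n) - evalVec (w n) (t n)) (z (t n) - evalVec (w n) (t n)) +
          bform (Ktilde P K) (z (t (n + 1)) - evalVec (w n) (t (n + 1)))
            (z (t (n + 1)) - evalVec (w n) (t (n + 1))))) +
      4 * ∑ n ∈ Finset.range (m + 1), bform (Ktilde P K)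
        (z (t (n + 1)) - evalVec (w n) (t (n + 1))) (z (t (n + 1)) - evalVec (w n) (t (n + 1))) ≤
      6 * M * ∑ n ∈ Finset.range (m + 1), slabError (t n) (t (n + 1)) (r n) z := by
    rw [Finset.mul_sum, Finset.mul_sum, Finset.mul_sum, ← Finset.sum_add_distrib]
    refine Finset.sum_le_sum fun n hn => ?_
    rw [Finset.mem_range] at hn
    have hle := (ht.lt n hn).le
    have k1 := bform_Ktilde_le hP hK hPM hKM (z (t n) - evalVec (w n) (t n))
    have k2 := bform_Ktilde_le hP hK hPM hKM (z (t (n + 1)) - evalVec (w n) (t (n + 1)))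
    have k3 : ∫ τ in t n..t (n + 1), ‖act (Ltilde L) (z τ - evalVec (w n) τ)‖ ^ 2 ≤
        M * ∫ τ in t n..t (n + 1), ‖z τ - evalVec (w n) τ‖ ^ 2 := by
      rw [← intervalIntegral.integral_const_mul]
      have hc := hηc n hn
      rw [← uIcc_of_le hle] at hc
      exact intervalIntegral.integral_mono_on hle
        (((continuous_act _).comp_continuousOn hc).norm.pow 2).intervalIntegrable
        ((hc.norm.pow 2).intervalIntegrable.const_mul M)
        fun τ _ => norm_act_Ltilde_sq_le hL hLM _
    have k4 : 0 ≤ M * ∫ τ in t n..t (n + 1), ‖z τ - evalVec (w n) τ‖ ^ 2 :=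
      mul_nonneg hM (intervalIntegral.integral_nonneg hle fun τ _ => by positivity)
    have k5 : 0 ≤ M * ‖z (t n) - evalVec (w n) (t n)‖ ^ 2 := by positivity
    change _ ≤ 6 * M * (‖z (t (n + 1)) - evalVec (w n) (t (n + 1))‖ ^ 2 +
      ‖z (t n) - evalVec (w n) (t n)‖ ^ 2 + ∫ τ in t n..t (n + 1), ‖z τ - evalVec (w n) τ‖ ^ 2)
    linarith
  linarith

theorem slabError_nonneg {a b : ℝ} (hab : a ≤ b) (n : ℕ) (z : ℝ → State d) :
    0 ≤ slabError a b n z := by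
  have := intervalIntegral.integral_nonneg hab (μ := volume)
    (f := fun τ => ‖z τ - evalVec (vecProj a b n z) τ‖ ^ 2) fun τ _ => by positivity
  unfold slabError
  positivity

end Estimate

end TimeDG

end

theorem mainTheorem4 (M : ℝ) :
    ∃ C : ℝ, 0 < C ∧
      ∀ (d : ℕ) (P L K : Matrix (Fin d) (Fin d) ℝ), P.PosDef → L.PosDef → K.PosDef →
      TimeDG.infNorm P ≤ M → TimeDG.infNorm L ≤ M → TimeDG.infNorm K ≤ M →
      ∀ (T : ℝ), 0 < T →
      ∀ (f : ℝ → EuclideanSpace ℝ (Fin d)),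
      MeasureTheory.MemLp f 2 (MeasureTheory.volume.restrict (Set.Ioc 0 T)) →
      ∀ (u₀ u₁ : EuclideanSpace ℝ (Fin d)) (z : ℝ → TimeDG.State d),
      TimeDG.IsSolution P L K f u₀ u₁ T z →
      ∀ (N : ℕ) (t : ℕ → ℝ), TimeDG.IsPartition T N t →
      ∀ (r s : ℕ → ℕ) (zDG : ℝ → TimeDG.State d),
      TimeDG.IsDGSolution P L K f u₀ u₁ N t r zDG →
      (∀ n < N, 2 ≤ s n ∧ TimeDG.MemSobolev (s n) (t n) (t (n + 1)) z) →
      ENNReal.ofReal (TimeDG.energyNorm P L K T N t (fun τ => z τ - zDG τ)) ≤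
        ENNReal.ofReal C * ∑ n ∈ Finset.range N,
          ENNReal.ofReal
              (TimeDG.hpFactor (t (n + 1) - t n) (r n) (min (r n) (s n))) *
            TimeDG.sobolevNorm (min (r n) (s n) + 1) (t n) (t (n + 1)) z := by
  -- The summand `1` only secures positivity, since the root vanishes for `M ≤ 0`.
  refine ⟨3 * Real.sqrt (6 * M) + 1, by positivity, ?_⟩
  intro d P L K hP hL hK hPM hLM hKM T hT f _ u₀ u₁ z hz N t ht r s zDG hDG _
  -- Without slabs one would have `0 = t 0 = T`, contrary to `0 < T`.
  obtain ⟨m, rfl⟩ : ∃ m, N = m + 1 := by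
    rcases N with _ | m
    · exact absurd (ht.zero.symm.trans ht.last) hT.ne
    · exact ⟨m, rfl⟩
  have hM : 0 ≤ M := (TimeDG.infNorm_nonneg L).trans hLM
  have h1 := TimeDG.energyNorm_error_le hP hL hK hPM hLM hKM hT hz ht hDG
  have hlt : ∀ n ∈ Finset.range (m + 1), t n < t (n + 1) := fun n hn =>
    ht.lt n (Finset.mem_range.1 hn)
  rw [Real.sqrt_mul (by positivity)] at h1
  have h2 := TimeDG.sqrt_sum_le_sum_sqrt (Finset.range (m + 1))
    (fun n => TimeDG.slabError (t n) (t (n + 1)) (r n) z)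
    fun n hn => TimeDG.slabError_nonneg (hlt n hn).le _ _
  have hzc : ∀ n ∈ Finset.range (m + 1), ContinuousOn z (Set.Icc (t n) (t (n + 1))) :=
    fun n hn => by
      rw [Finset.mem_range] at hn
      refine hz.cont.mono (Set.Icc_subset_Icc ?_ ?_)
      · rw [← ht.zero]; exact TimeDG.partition_mono ht.lt (Nat.zero_le n) hn.le
      · rw [← ht.last]; exact TimeDG.partition_mono ht.lt (Nat.succ_le_of_lt hn) le_rfl
  calc _ ≤ ENNReal.ofReal (Real.sqrt (6 * M) * ∑ n ∈ Finset.range (m + 1),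
        Real.sqrt (TimeDG.slabError (t n) (t (n + 1)) (r n) z)) :=
        ENNReal.ofReal_le_ofReal (h1.trans (mul_le_mul_of_nonneg_left h2 (Real.sqrt_nonneg _)))
    _ = ENNReal.ofReal (Real.sqrt (6 * M)) * ∑ n ∈ Finset.range (m + 1),
        ENNReal.ofReal (Real.sqrt (TimeDG.slabError (t n) (t (n + 1)) (r n) z)) := by
        rw [ENNReal.ofReal_mul (Real.sqrt_nonneg _),
          ENNReal.ofReal_sum_of_nonneg fun _ _ => Real.sqrt_nonneg _]
    _ ≤ ENNReal.ofReal (Real.sqrt (6 * M)) * ∑ n ∈ Finset.range (m + 1), (ENNReal.ofReal 3 *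
          (ENNReal.ofReal (TimeDG.hpFactor (t (n + 1) - t n) (r n) (min (r n) (s n))) *
            TimeDG.sobolevNorm (min (r n) (s n) + 1) (t n) (t (n + 1)) z)) := by
        gcongr with n hn
        rw [← mul_assoc, ← ENNReal.ofReal_mul (by norm_num)]
        exact TimeDG.sqrt_slabError_le (hlt n hn) (min_le_left _ _) (hzc n hn)
    _ ≤ _ := by
        rw [← Finset.mul_sum, ← mul_assoc, ← ENNReal.ofReal_mul (Real.sqrt_nonneg _)]
        gcongr
        linarith
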